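/- \textbf{Setting.} Let $d,n\ge 1$, index the entries of vectors of $\mathbb{R}^d$ by $0,\dots,d-1$ modulo $d$, and write $[w\star x]_i=\frac1{\sqrt d}\sum_{k}[w]_{-k}[x]_{i+k}$ for the 1-D circular convolution and $[\mathcal F(w)]_k=\frac1{\sqrt d}\sum_j [w]_j e^{-2\pi \mathrm{i} jk/d}$ for the discrete Fourier transform. A two-layer linear convolutional network with weights $W=(w_1,w_2)\in\mathbb{R}^d\times\mathbb{R}^d$ is $\varphi(x;W)=w_2^\top(w_1\star x)$; let $\beta(W)\in\mathbb{R}^d$ be the vector with $\varphi(x;W)=\langle\beta(W),x\rangle$ for all $x$. For a dataset $x_1,\dots,x_n\in\mathbb{R}^d$ with labels $y_i\in\{-1,+1\}$ let $$\mathcal L(W)=\frac1n\sum_{i=1}^n e^{-y_i\varphi(x_i;W)},\qquad \ell(\beta)=\frac1n\sum_{i=1}^n e^{-y_i\langle\beta,x_i\rangle}.$$ The gradient descent iterates are $W_{t+1}=W_t-\eta_t\nabla\mathcal L(W_t)$. A sequence $u_t$ converges in direction to $v$ if $u_t/\|u_t\|_2\to v$. \textbf{Corollary (Maximally robust to perturbations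 with bounded Fourier coefficients).} Fix the labels. For Lebesgue-almost all $(x_1,\dots,x_n)$ for which the dataset is linearly separable (there is $w$ with $y_i\langle w,x_i\rangle>0$ for all $i$), for Lebesgue-almost all initializations $W_0\in\mathbb{R}^d\times\mathbb{R}^d$, and for every step-size sequence $(\eta_t)$, the following holds. Suppose that 1. for all $t$, $\eta_t>0$ and $\eta_t\,\|\nabla^2\mathcal L(W_t)\|<1$ (operator norm), i.e. the step size is below the inverse of the local Lipschitz constant of $\nabla\mathcal L$ at $W_t$; 2. $\mathcal L(W_t)\to0$; 3. $W_t$ converges in direction to some $V$ with $y_i\varphi(x_i;V)>0$ for all $i$; 4. the gradients $\nabla\ell(\beta(W_t))$ with respect to the linear predictor converge in direction. Then $\beta(W_t)$ converges in direction to $\beta(U)$ for some weights $U$ for which $\varphi(\cdot;U)$ is a maximally robust classifier with respect to perturbations $\delta\in\mathbb{R}^d$ with $\ell_\infty$-bounded Fourier coefficients: $U$ maximizes, over all $W=(w_1,w_2)\in\mathbb{R}^d\times\mathbb{R}^d$, $$\sup\{\varepsilon\ge0 \;:\; y_i\,\varphi(x_i+\delta;W)>0\ \text{ for all } i \text{ and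 all } \delta\in\mathbb{R}^d \text{ with } \|\mathcal F(\delta)\|_\infty\le\varepsilon\}$$ (the supremum of the empty set being $0$). -/

import Mathlib

open Filter Topology MeasureTheory
open scoped NNReal ENNReal

noncomputable section

namespace LinConv

/-- Signals in `ℝ^d` with the Euclidean norm, indexed by `0, …, d-1` modulo `d`. -/
abbrev Signal (d : ℕ) : Type := EuclideanSpace ℝ (ZMod d)

/-- Weights `(w₁, w₂) ∈ ℝ^d × ℝ^d` of a two-layer network, with the Euclidean norm of `ℝ^(2d)`. -/
abbrev Params (d : ℕ) : Type := WithLp 2 (Signal d × Signal d)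

variable {d n : ℕ} [NeZero d]

/-- Circular convolution `[w ⋆ x]_i = d^(-1/2) ∑_k [w]_(-k) [x]_(i+k)`, indices modulo `d`. -/
def circConv (w x : Signal d) : Signal d :=
  WithLp.toLp 2 fun i => (1 / √(d : ℝ)) * ∑ k : ZMod d, w (-k) * x (i + k)

/-- The two-layer linear convolutional network `x ↦ w₂ᵀ (w₁ ⋆ x)`. -/
def netOutput (W : Params d) (x : Signal d) : ℝ :=
  inner ℝ W.snd (circConv W.fst x)

/-- The weight vector `w` of the linear model that the network computes
(see `netOutput_eq_inner`): its `m`-th entry is the output on the `m`-th unit vector. -/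
def predictor (W : Params d) : Signal d :=
  WithLp.toLp 2 fun m => netOutput W (EuclideanSpace.single m 1)

theorem netOutput_add (W : Params d) (x z : Signal d) :
    netOutput W (x + z) = netOutput W x + netOutput W z := by
  unfold netOutput
  rw [← inner_add_right]
  congr 1
  ext i
  simp [circConv, mul_add, Finset.sum_add_distrib]

theorem netOutput_smul (W : Params d) (c : ℝ) (x : Signal d) :
    netOutput W (c • x) = c * netOutput W x := by
  unfold netOutput
  rw [← real_inner_smul_right]
  congr 1
  ext i
  simp only [circConv, PiLp.smul_apply, smul_eq_mul, Finset.mul_sum]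
  refine Finset.sum_congr rfl fun k _ => ?_
  ring

theorem netOutput_eq_inner (W : Params d) (x : Signal d) :
    netOutput W x = inner ℝ (predictor W) x := by
  let f : Signal d →ₗ[ℝ] ℝ :=
    { toFun := netOutput W
      map_add' := netOutput_add W
      map_smul' := fun c x => by simpa using netOutput_smul W c x }
  let g : Signal d →ₗ[ℝ] ℝ := (innerSL ℝ (predictor W)).toLinearMap
  have h : f = g := by
    refine (EuclideanSpace.basisFun (ZMod d) ℝ).toBasis.ext fun m => ?_
    simp [f, g, predictor, EuclideanSpace.inner_single_right]
  exact congrArg (fun l : Signal d →ₗ[ℝ] ℝ => l x) h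

/-- Unitary discrete Fourier transform
`[F(w)]_k = d^(-1/2) ∑_j [w]_j exp(-2πi j k / d)`. The type `ZMod d → ℂ` carries the sup norm,
so `‖fourier w‖` is the `ℓ∞` norm of the Fourier coefficients. -/
def fourier (w : Signal d) : ZMod d → ℂ := fun k =>
  (1 / √(d : ℝ) : ℝ) * ZMod.dft (fun j => (w j : ℂ)) k

/-- The dataset is strictly separated by a hyperplane through the origin. -/
def LinearlySeparable (x : Fin n → Signal d) (y : Fin n → ℝ) : Prop :=
  ∃ w : Signal d, ∀ i, 0 < y i * inner ℝ w (x i)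

/-- Empirical risk of a linear model `w` with the exponential loss. -/
def linearRisk (x : Fin n → Signal d) (y : Fin n → ℝ) (w : Signal d) : ℝ :=
  (1 / (n : ℝ)) * ∑ i, Real.exp (-(y i * inner ℝ w (x i)))

/-- Empirical risk of the network with the exponential loss. -/
def netRisk (x : Fin n → Signal d) (y : Fin n → ℝ) (W : Params d) : ℝ :=
  (1 / (n : ℝ)) * ∑ i, Real.exp (-(y i * netOutput W (x i)))

/-- Gradient descent on the weights of the network. -/
def gdIterates (x : Fin n → Signal d) (y : Fin n → ℝ) (η : ℕ → ℝ) (W₀ : Params d) :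
    ℕ → Params d
  | 0 => W₀
  | t + 1 => gdIterates x y η W₀ t -
      η t • gradient (netRisk x y) (gdIterates x y η W₀ t)

/-- The Hessian of the network risk. Its operator norm at `W` is the local Lipschitz constant
of the gradient at `W`. -/
def hessian (x : Fin n → Signal d) (y : Fin n → ℝ) (W : Params d) : Params d →L[ℝ] Params d :=
  fderiv ℝ (gradient (netRisk x y)) W

/-- `u t / ‖u t‖ → v`. -/
def ConvergesInDirection {E : Type*} [NormedAddCommGroup E] [NormedSpace ℝ E]
    (u : ℕ → E) (v : E) : Prop :=
  Tendsto (fun t => ‖u t‖⁻¹ • u t) atTop (𝓝 v)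

/-- Every training point stays correctly classified under all perturbations whose Fourier
coefficients are bounded by `ε`. -/
def RobustAt (x : Fin n → Signal d) (y : Fin n → ℝ) (W : Params d) (ε : ℝ≥0) : Prop :=
  ∀ i, ∀ δ : Signal d, ‖fourier δ‖ ≤ (ε : ℝ) → 0 < y i * netOutput W (x i + δ)

/-- The supremum of the radii `ε` at which the network is robust. -/
def robustRadius (x : Fin n → Signal d) (y : Fin n → ℝ) (W : Params d) : ℝ≥0∞ :=
  ⨆ (ε : ℝ≥0) (_ : RobustAt x y W ε), (ε : ℝ≥0∞)

/-- The network with weights `W` attains the maximum, over all two-layer networks, of the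
robustness radius. -/
def IsMaximallyRobust (x : Fin n → Signal d) (y : Fin n → ℝ) (W : Params d) : Prop :=
  ∀ W' : Params d, robustRadius x y W' ≤ robustRadius x y W

end LinConv

end

open Filter Topology MeasureTheory
open scoped NNReal ENNReal ComplexConjugate

noncomputable section

namespace LinConv

/-! The robust radius of a network is its margin divided by the `ℓ¹` norm of `fourier β`, with `β`
its predictor, because that norm is dual to the `ℓ∞` bound on the perturbations. For `‖V‖ = 1` this
norm is at most `1/2` (`two_mul_fourierL1_predictor_le`), so a limit direction `V` with margin `γ`
is robust at every radius below `2γ`. It remains to show that no network exceeds `2γ`.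

The certificate is the limit direction `Z` of the negative gradients `z` of the linear risk. These
are averages of the `y i • x i` with weights `exp (-margin)`, which concentrate on the smallest
margins of `V`; hence `r * netOutput V Z ≤ γ * ⟪β, Z⟫` for every `β` with margin at least `r`
(`inner_limit_direction`). Together with `‖fourier Z k‖ ≤ 2 * netOutput V Z` for all `k`, Hölder's
inequality gives the bound `2γ` (`isMaximallyRobust_of_certificate`).

The bound on `fourier Z` comes from the dynamics. The update is linear in `W` once `z` is given, and
it splits over frequencies: with `p`, `q` the `k`-th coefficients of the two layers and `c` that of
`z / ‖z‖`, it reads `p ↦ p + s c̄ q`, `q ↦ q + s c p`. The matrix has eigenvalues `±|c|`, so a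
generic mode gains energy at relative rate `2 ‖fourier Z k‖`, whereas `‖W‖²` grows at rate `4 *
netOutput V Z`; a part cannot outgrow the whole (`two_mul_norm_le_of_growth`). Genericity is `|p| ≠
|q|` at time `0`, an almost sure condition that small steps preserve. The Hessian condition on the
step size yields both `s |c| < 1` and `s → 0`. -/

variable {d n : ℕ} [NeZero d]

/-! ### Fourier analysis on `ZMod d`: convolution, Parseval, and `ℓ¹`–`ℓ∞` duality. -/

/-- The norm dual to `‖fourier ·‖`: the `ℓ¹` norm of the Fourier
coefficients. -/
def fourierL1 (w : Signal d) : ℝ := ∑ k, ‖fourier w k‖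

theorem inv_sqrt_mul_self (d : ℕ) : ((1 / √(d : ℝ) : ℝ) : ℂ) * ((1 / √(d : ℝ) : ℝ) : ℂ) = (d : ℂ)⁻¹ := by
  rw [← Complex.ofReal_mul, div_mul_div_comm, Real.mul_self_sqrt (Nat.cast_nonneg d)]
  simp

theorem fourier_apply (w : Signal d) (k : ZMod d) :
    fourier w k = ((1 / √(d : ℝ) : ℝ) : ℂ) * ∑ j, ZMod.stdAddChar (-(j * k)) * (w j : ℂ) := by
  simp [fourier, ZMod.dft_apply]

theorem conj_stdAddChar (a : ZMod d) :
    conj (ZMod.stdAddChar a : ℂ) = ZMod.stdAddChar (-a) :=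
  (AddChar.map_neg_eq_conj _ _).symm

theorem circConv_apply (w x : Signal d) (i : ZMod d) :
    circConv w x i = (1 / √(d : ℝ)) * ∑ j, w j * x (i - j) := by
  simp only [circConv]
  congr 1
  refine Fintype.sum_equiv (Equiv.neg _) _ _ fun k => ?_
  simp

theorem fourier_circConv (w x : Signal d) (k : ZMod d) :
    fourier (circConv w x) k = fourier w k * fourier x k := by
  have key : ∑ i, ∑ j, ZMod.stdAddChar (-(i * k)) * ((w j : ℂ) * (x (i - j) : ℂ)) =
      (∑ j, ZMod.stdAddChar (-(j * k)) * (w j : ℂ)) *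
        ∑ j, ZMod.stdAddChar (-(j * k)) * (x j : ℂ) := by
    rw [Finset.sum_comm, Finset.sum_mul]
    refine Finset.sum_congr rfl fun j _ => ?_
    rw [Finset.mul_sum]
    refine Fintype.sum_equiv (Equiv.subRight j) _ _ fun i => ?_
    have : -(i * k) = -(j * k) + -((i - j) * k) := by ring
    simp only [Equiv.subRight_apply]
    rw [this, AddChar.map_add_eq_mul]
    ring
  rw [fourier_apply, fourier_apply, fourier_apply, mul_mul_mul_comm, ← key, mul_assoc]
  congr 1
  rw [Finset.mul_sum]
  refine Finset.sum_congr rfl fun i _ => ?_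
  rw [circConv_apply]
  push_cast
  rw [← Finset.mul_sum]
  ring

theorem sum_conj_fourier_mul (w : Signal d) (f : ZMod d → ℂ) :
    ∑ k, conj (fourier w k) * f k =
      ∑ j, (w j : ℂ) *
        (((1 / √(d : ℝ) : ℝ) : ℂ) * ∑ k, ZMod.stdAddChar (j * k) * f k) := by
  simp only [fourier_apply, map_mul, map_sum, Complex.conj_ofReal, conj_stdAddChar, neg_neg,
    Finset.mul_sum, Finset.sum_mul]
  rw [Finset.sum_comm]
  refine Finset.sum_congr rfl fun j _ => Finset.sum_congr rfl fun k _ => ?_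
  ring

theorem sum_stdAddChar_mul_fourier (x : Signal d) (j : ZMod d) :
    ((1 / √(d : ℝ) : ℝ) : ℂ) * ∑ k, ZMod.stdAddChar (j * k) * fourier x k = x j := by
  have h : ∑ k, ZMod.stdAddChar (j * k) * fourier x k =
      ((1 / √(d : ℝ) : ℝ) : ℂ) * ∑ l, (x l : ℂ) * ∑ k, ZMod.stdAddChar (k * (j - l)) := by
    simp only [fourier_apply, Finset.mul_sum]
    rw [Finset.sum_comm]
    refine Finset.sum_congr rfl fun l _ => Finset.sum_congr rfl fun k _ => ?_
    have : k * (j - l) = j * k + -(l * k) := by ring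
    rw [this, AddChar.map_add_eq_mul]
    ring
  rw [h, ← mul_assoc, inv_sqrt_mul_self]
  simp only [AddChar.sum_mulShift _ (ZMod.isPrimitive_stdAddChar d), sub_eq_zero]
  have hd : (d : ℂ) ≠ 0 := NeZero.ne _
  simp
  field_simp

/-- Parseval's identity for the unitary discrete Fourier transform. -/
theorem sum_conj_fourier_mul_fourier (w x : Signal d) :
    ∑ k, conj (fourier w k) * fourier x k = ((inner ℝ w x : ℝ) : ℂ) := by
  simp only [sum_conj_fourier_mul, sum_stdAddChar_mul_fourier, PiLp.inner_apply]
  push_cast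
  refine Finset.sum_congr rfl fun j _ => ?_
  simp [mul_comm]

theorem sum_norm_sq_fourier (w : Signal d) : ∑ k, ‖fourier w k‖ ^ 2 = ‖w‖ ^ 2 := by
  have h := sum_conj_fourier_mul_fourier w w
  rw [real_inner_self_eq_norm_sq] at h
  simp only [Complex.conj_mul'] at h
  exact_mod_cast h

theorem inner_le_of_norm_fourier_le {w z : Signal d} {M : ℝ} (h : ∀ k, ‖fourier z k‖ ≤ M) :
    inner ℝ w z ≤ M * fourierL1 w := by
  have h1 : ‖((inner ℝ w z : ℝ) : ℂ)‖ ≤ M * fourierL1 w := by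
    rw [← sum_conj_fourier_mul_fourier, fourierL1, Finset.mul_sum]
    refine norm_sum_le_of_le _ fun k _ => ?_
    rw [norm_mul, RCLike.norm_conj, mul_comm]
    exact mul_le_mul_of_nonneg_right (h k) (norm_nonneg _)
  rw [Complex.norm_real] at h1
  exact (le_abs_self _).trans h1

/-- The pairing of `w` with signals whose Fourier coefficients have modulus at most one attains
the `ℓ¹` norm of the Fourier coefficients of `w`. -/
theorem exists_inner_eq_fourierL1 (w : Signal d) :
    ∃ δ : Signal d, ‖fourier δ‖ ≤ 1 ∧ inner ℝ w δ = fourierL1 w := by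
  -- The phases of `fourier w`; where the coefficient vanishes, `0 / 0 = 0` still has modulus at
  -- most one.
  let f : ZMod d → ℂ := fun k => fourier w k / (‖fourier w k‖ : ℂ)
  have hf : ∀ k, ‖f k‖ ≤ 1 := fun k => by
    simp only [f, norm_div, Complex.norm_real, norm_norm]
    exact div_self_le_one _
  let g : ZMod d → ℂ := fun j => ((1 / √(d : ℝ) : ℝ) : ℂ) * ∑ k, ZMod.stdAddChar (j * k) * f k
  let F : (ZMod d → ℂ) → ZMod d → ℂ := fun h k =>
    ((1 / √(d : ℝ) : ℝ) : ℂ) * ∑ j, ZMod.stdAddChar (-(j * k)) * h j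
  have hFg : F g = f := by
    funext k
    have h1 : ∑ j, ZMod.stdAddChar (-(j * k)) * g j =
        ((1 / √(d : ℝ) : ℝ) : ℂ) * ∑ l, f l * ∑ j, ZMod.stdAddChar (j * (l - k)) := by
      simp only [g, Finset.mul_sum]
      rw [Finset.sum_comm]
      refine Finset.sum_congr rfl fun l _ => Finset.sum_congr rfl fun j _ => ?_
      have : j * (l - k) = -(j * k) + j * l := by ring
      rw [this, AddChar.map_add_eq_mul]
      ring
    simp only [F]
    rw [h1, ← mul_assoc, inv_sqrt_mul_self]
    simp only [AddChar.sum_mulShift _ (ZMod.isPrimitive_stdAddChar d), sub_eq_zero]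
    have hd : (d : ℂ) ≠ 0 := NeZero.ne _
    simp
    field_simp
  have hFconj : ∀ k, F (fun j => conj (g j)) k = conj (F g (-k)) := fun k => by
    simp only [F, map_mul, map_sum, Complex.conj_ofReal, conj_stdAddChar, neg_neg, mul_neg]
  -- Taking the real part replaces `f k` by the mean of `f k` and `conj (f (-k))`, which keeps the
  -- bound, and pairing with the real signal `w` sees only real parts. So `g` need not be shown
  -- real.
  refine ⟨WithLp.toLp 2 fun j => (g j).re, ?_, ?_⟩
  · refine (pi_norm_le_iff_of_nonneg zero_le_one).2 fun k => ?_
    have h1 : fourier (WithLp.toLp 2 fun j => (g j).re : Signal d) k =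
        (F g k + conj (F g (-k))) / 2 := by
      rw [← hFconj, fourier_apply]
      simp only [F]
      rw [← mul_add, ← Finset.sum_add_distrib, mul_div_assoc, Finset.sum_div]
      congr 1
      refine Finset.sum_congr rfl fun j _ => ?_
      rw [← mul_add, Complex.add_conj]
      push_cast
      ring
    rw [h1, hFg, norm_div, Complex.norm_ofNat, div_le_one two_pos]
    refine (norm_add_le _ _).trans ?_
    rw [RCLike.norm_conj]
    linarith [hf k, hf (-k)]
  · have h1 := sum_conj_fourier_mul w f
    have h2 : ∑ k, conj (fourier w k) * f k = ((fourierL1 w : ℝ) : ℂ) := by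
      rw [fourierL1]
      push_cast
      refine Finset.sum_congr rfl fun k _ => ?_
      simp only [f]
      rw [← mul_div_assoc, Complex.conj_mul', pow_two, mul_self_div_self]
    rw [h2] at h1
    have h3 := congrArg Complex.re h1
    rw [Complex.ofReal_re, Complex.re_sum] at h3
    rw [h3, PiLp.inner_apply]
    refine Finset.sum_congr rfl fun j _ => ?_
    rw [Complex.re_ofReal_mul]
    simp [g, mul_comm]

theorem fourier_add (w x : Signal d) (k : ZMod d) :
    fourier (w + x) k = fourier w k + fourier x k := by
  simp [fourier_apply, mul_add, Finset.sum_add_distrib]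

theorem fourier_smul (c : ℝ) (w : Signal d) (k : ZMod d) :
    fourier (c • w) k = c * fourier w k := by
  simp only [fourier_apply, PiLp.smul_apply, smul_eq_mul, Finset.mul_sum]
  refine Finset.sum_congr rfl fun j _ => ?_
  push_cast
  ring

theorem norm_fourier_smul {c : ℝ} (hc : 0 ≤ c) (w : Signal d) :
    ‖fourier (c • w)‖ = c * ‖fourier w‖ := by
  have : fourier (c • w) = (c : ℂ) • fourier w := funext fun k => fourier_smul c w k
  rw [this, norm_smul, Complex.norm_real, Real.norm_of_nonneg hc]

theorem continuous_fourier_apply (k : ZMod d) : Continuous fun w : Signal d => fourier w k := by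
  simp only [fourier_apply]
  fun_prop

theorem fourier_single_zero (k : ZMod d) :
    fourier (EuclideanSpace.single 0 1 : Signal d) k = ((1 / √(d : ℝ) : ℝ) : ℂ) := by
  rw [fourier_apply, Finset.sum_eq_single 0]
  · simp
  · intro j _ hj
    simp [hj]
  · simp

/-- Characters are eigenvectors of convolution by `z`, with the Fourier coefficients as eigenvalues.
Since the hypothesis concerns real signals, it is applied to the real and imaginary parts of a
character and the two bounds are added. -/
theorem norm_fourier_le_of_circConv {z : Signal d} {h : ℝ}
    (hz : ∀ w, ‖circConv w z‖ ^ 2 ≤ h ^ 2 * ‖w‖ ^ 2) (hh : 0 ≤ h) (k : ZMod d) :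
    ‖fourier z k‖ ≤ h := by
  let ψ : ZMod d → ℂ := fun j => ZMod.stdAddChar (j * k)
  let p : Signal d := WithLp.toLp 2 fun j => (ψ j).re
  let q : Signal d := WithLp.toLp 2 fun j => (ψ j).im
  have hψ : ∀ j, ‖ψ j‖ = 1 := fun j => AddChar.norm_apply _ _
  have hconv : ∀ i, ((1 / √(d : ℝ) : ℝ) : ℂ) * ∑ j, ψ j * (z (i - j) : ℂ) =
      ψ i * fourier z k := fun i => by
    rw [fourier_apply, mul_left_comm, Finset.mul_sum (a := ψ i)]
    congr 1
    refine Fintype.sum_equiv (Equiv.subLeft i) _ 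
      (fun l => ψ i * (ZMod.stdAddChar (-(l * k)) * (z l : ℂ))) fun j => ?_
    have : j * k = i * k + -((i - j) * k) := by ring
    simp only [ψ, Equiv.subLeft_apply]
    rw [this, AddChar.map_add_eq_mul]
    ring
  have hp : ∀ i, circConv p z i = (ψ i * fourier z k).re := fun i => by
    rw [← hconv, circConv_apply, Complex.re_ofReal_mul, Complex.re_sum]
    simp [p]
  have hq : ∀ i, circConv q z i = (ψ i * fourier z k).im := fun i => by
    rw [← hconv, circConv_apply, Complex.im_ofReal_mul, Complex.im_sum]
    simp [q]
  have sq : ∀ c : ℂ, c.re ^ 2 + c.im ^ 2 = ‖c‖ ^ 2 := fun c => by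
    rw [← Complex.normSq_eq_norm_sq, Complex.normSq_apply]
    ring
  have h1 : ‖p‖ ^ 2 + ‖q‖ ^ 2 = d := by
    rw [EuclideanSpace.real_norm_sq_eq, EuclideanSpace.real_norm_sq_eq, ← Finset.sum_add_distrib]
    simp [p, q, sq, hψ]
  have h2 : ‖circConv p z‖ ^ 2 + ‖circConv q z‖ ^ 2 = d * ‖fourier z k‖ ^ 2 := by
    rw [EuclideanSpace.real_norm_sq_eq, EuclideanSpace.real_norm_sq_eq, ← Finset.sum_add_distrib]
    simp only [hp, hq, sq, norm_mul, hψ]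
    simp
  have hd : (0 : ℝ) < d := Nat.cast_pos.2 (NeZero.pos d)
  have h3 : d * ‖fourier z k‖ ^ 2 ≤ d * h ^ 2 := by
    have := add_le_add (hz p) (hz q)
    rw [h2, ← mul_add, h1] at this
    linarith
  exact le_of_sq_le_sq (le_of_mul_le_mul_left h3 hd) hh

/-! ### The output as a quadratic form in the weights; gradients and Hessian. -/

/-- The signal read backwards. -/
def reflect (z : Signal d) : Signal d := WithLp.toLp 2 fun j => z (-j)

/-- Reflection gives the adjoint of convolution by `z`; this makes `netMap z` self-adjoint. -/
theorem inner_circConv_comm (v w z : Signal d) :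
    inner ℝ v (circConv w z) = inner ℝ w (circConv v (reflect z)) := by
  simp only [PiLp.inner_apply, circConv_apply, reflect, RCLike.inner_apply, conj_trivial,
    Finset.mul_sum, Finset.sum_mul]
  rw [Finset.sum_comm]
  refine Finset.sum_congr rfl fun j _ => Finset.sum_congr rfl fun i _ => ?_
  rw [neg_sub]
  ring

theorem fourier_reflect (z : Signal d) (k : ZMod d) :
    fourier (reflect z) k = conj (fourier z k) := by
  simp only [fourier_apply, map_mul, map_sum, Complex.conj_ofReal, conj_stdAddChar, neg_neg]
  congr 1
  refine Fintype.sum_equiv (Equiv.neg _) _ _ fun j => ?_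
  simp [reflect]

theorem circConv_add_left (v w z : Signal d) :
    circConv (v + w) z = circConv v z + circConv w z := by
  ext i
  simp [circConv_apply, add_mul, mul_add, Finset.sum_add_distrib]

theorem circConv_smul_left (c : ℝ) (w z : Signal d) : circConv (c • w) z = c • circConv w z := by
  ext i
  simp [circConv_apply, Finset.mul_sum, mul_left_comm, mul_assoc]

theorem circConv_add_right (w x z : Signal d) :
    circConv w (x + z) = circConv w x + circConv w z := by
  ext i
  simp [circConv_apply, mul_add, Finset.sum_add_distrib]

theorem circConv_smul_right (c : ℝ) (w z : Signal d) : circConv w (c • z) = c • circConv w z := by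
  ext i
  simp [circConv_apply, Finset.mul_sum, mul_left_comm]

theorem params_ext {d : ℕ} {V W : Params d} (h₁ : V.fst = W.fst) (h₂ : V.snd = W.snd) : V = W :=
  WithLp.ofLp_injective 2 (Prod.ext h₁ h₂)

/-- The linear operator on weights whose quadratic form at `W` is twice the output of the
network on `z`. -/
def netMapLin (z : Signal d) : Params d →ₗ[ℝ] Params d where
  toFun W := WithLp.toLp 2 (circConv W.snd (reflect z), circConv W.fst z)
  map_add' _ _ := params_ext (circConv_add_left _ _ _) (circConv_add_left _ _ _)
  map_smul' _ _ := params_ext (circConv_smul_left _ _ _) (circConv_smul_left _ _ _)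

instance : ContinuousSMul ℝ (Params d) := IsBoundedSMul.continuousSMul

instance : IsTopologicalAddGroup (Params d) := SeminormedAddCommGroup.toIsTopologicalAddGroup

/-- Circular convolution with a fixed signal. -/
def circConvL (z : Signal d) : Signal d →L[ℝ] Signal d :=
  LinearMap.toContinuousLinearMap
    { toFun := fun w => circConv w z
      map_add' := fun v w => circConv_add_left v w z
      map_smul' := fun c w => circConv_smul_left c w z }

theorem continuous_netMapLin (z : Signal d) : Continuous (netMapLin z) :=
  (WithLp.prod_continuous_toLp 2 _ _).comp
    (((circConvL (reflect z)).continuous.comp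
      (WithLp.sndL 2 ℝ (Signal d) (Signal d)).continuous).prodMk
    ((circConvL z).continuous.comp (WithLp.fstL 2 ℝ (Signal d) (Signal d)).continuous))

theorem netMapLin_add (x z : Signal d) : netMapLin (x + z) = netMapLin x + netMapLin z :=
  LinearMap.ext fun W => params_ext (circConv_add_right W.snd (reflect x) (reflect z))
    (circConv_add_right W.fst x z)

theorem netMapLin_smul (c : ℝ) (z : Signal d) : netMapLin (c • z) = c • netMapLin z :=
  LinearMap.ext fun W => params_ext (circConv_smul_right c W.snd (reflect z))
    (circConv_smul_right c W.fst z)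

/-- The self-adjoint operator on weights whose quadratic form at `W` is twice the output of the
network on `z`, as a function of `z`. -/
def netMap : Signal d →ₗ[ℝ] Params d →L[ℝ] Params d where
  toFun z := ⟨netMapLin z, continuous_netMapLin z⟩
  map_add' x z := ContinuousLinearMap.coe_injective (netMapLin_add x z)
  map_smul' c z := ContinuousLinearMap.coe_injective (netMapLin_smul c z)

theorem netMap_fst (z : Signal d) (W : Params d) :
    (netMap z W).fst = circConv W.snd (reflect z) := rfl

theorem netMap_snd (z : Signal d) (W : Params d) : (netMap z W).snd = circConv W.fst z := rfl

theorem fourier_netMap_fst (z : Signal d) (W : Params d) (k : ZMod d) :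
    fourier (netMap z W).fst k = conj (fourier z k) * fourier W.snd k := by
  rw [netMap_fst, fourier_circConv, fourier_reflect, mul_comm]

theorem fourier_netMap_snd (z : Signal d) (W : Params d) (k : ZMod d) :
    fourier (netMap z W).snd k = fourier z k * fourier W.fst k := by
  rw [netMap_snd, fourier_circConv, mul_comm]

theorem inner_netMap_comm (z : Signal d) (V W : Params d) :
    inner ℝ V (netMap z W) = inner ℝ (netMap z V) W := by
  rw [real_inner_comm W]
  simp only [WithLp.prod_inner_apply]
  change inner ℝ V.fst (circConv W.snd (reflect z)) + inner ℝ V.snd (circConv W.fst z) =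
    inner ℝ W.fst (circConv V.snd (reflect z)) + inner ℝ W.snd (circConv V.fst z)
  rw [inner_circConv_comm V.snd, inner_circConv_comm W.snd]
  ring

theorem inner_netMap_self (z : Signal d) (W : Params d) :
    inner ℝ W (netMap z W) = 2 * netOutput W z := by
  simp only [WithLp.prod_inner_apply]
  change inner ℝ W.fst (circConv W.snd (reflect z)) + inner ℝ W.snd (circConv W.fst z) = _
  rw [← inner_circConv_comm, netOutput]
  ring

theorem netOutput_eq_half_inner (z : Signal d) (W : Params d) :
    netOutput W z = 1 / 2 * inner ℝ W (netMap z W) := by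
  rw [inner_netMap_self]
  ring

theorem hasFDerivAt_netOutput (z : Signal d) (W : Params d) :
    HasFDerivAt (fun V => netOutput V z) (innerSL ℝ (netMap z W)) W := by
  have h := ((hasFDerivAt_id W).inner ℝ (netMap z).hasFDerivAt).const_mul (1 / 2)
  refine (h.congr_fderiv ?_).congr_of_eventuallyEq
    (Eventually.of_forall fun V => netOutput_eq_half_inner z V)
  ext V
  simp only [smul_apply, ContinuousLinearMap.comp_apply, innerSL_apply_apply,
    ContinuousLinearMap.prod_apply, fderivInnerCLM_apply, smul_eq_mul, id]
  rw [inner_netMap_comm z W]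
  simp only [ContinuousLinearMap.id_apply]
  rw [real_inner_comm V]
  ring

theorem netOutput_smul_left (c : ℝ) (W : Params d) (x : Signal d) :
    netOutput (c • W) x = c ^ 2 * netOutput W x := by
  rw [netOutput_eq_half_inner, netOutput_eq_half_inner, map_smul, real_inner_smul_left,
    real_inner_smul_right]
  ring

theorem predictor_smul (c : ℝ) (W : Params d) : predictor (c • W) = c ^ 2 • predictor W := by
  ext m
  simp [predictor, netOutput_smul_left]

theorem continuous_netOutput_left (x : Signal d) :
    Continuous fun W : Params d => netOutput W x := by
  simp only [netOutput_eq_half_inner]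
  exact continuous_const.mul (continuous_id.inner (netMap x).continuous)

theorem continuous_predictor : Continuous (predictor : Params d → Signal d) := by
  refine (PiLp.continuous_toLp 2 _).comp (continuous_pi fun m => ?_)
  exact continuous_netOutput_left _

/-- The negative gradient of the linear risk: the average of the labelled data points with
weights `exp (-margin)`. -/
def weightedMean (x : Fin n → Signal d) (y : Fin n → ℝ) (w : Signal d) : Signal d :=
  (1 / (n : ℝ)) • ∑ i, (Real.exp (-(y i * inner ℝ w (x i))) * y i) • x i

theorem inner_weightedMean (x : Fin n → Signal d) (y : Fin n → ℝ) (v w : Signal d) :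
    inner ℝ v (weightedMean x y w) =
      (1 / (n : ℝ)) * ∑ i, Real.exp (-(y i * inner ℝ w (x i))) * (y i * inner ℝ v (x i)) := by
  rw [weightedMean, real_inner_smul_right, inner_sum]
  congr 1
  refine Finset.sum_congr rfl fun i _ => ?_
  rw [real_inner_smul_right]
  ring

theorem netMap_weightedMean (x : Fin n → Signal d) (y : Fin n → ℝ) (V W : Params d) :
    netMap (weightedMean x y (predictor V)) W =
      (1 / (n : ℝ)) • ∑ i, (Real.exp (-(y i * netOutput V (x i))) * y i) • netMap (x i) W := by
  simp only [weightedMean, map_smul, map_sum, netOutput_eq_inner]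
  simp

theorem gradient_linearRisk (x : Fin n → Signal d) (y : Fin n → ℝ) (w : Signal d) :
    gradient (linearRisk x y) w = -weightedMean x y w := by
  refine HasGradientAt.gradient (hasGradientAt_iff_hasFDerivAt.2 ?_)
  have h : ∀ i, HasFDerivAt (fun v : Signal d => Real.exp (-(y i * inner ℝ v (x i)))) _ w :=
    fun i => (((innerSL ℝ (x i)).hasFDerivAt.congr_of_eventuallyEq
      (Eventually.of_forall fun v => real_inner_comm (x i) v)).const_mul (y i)).neg.exp
  refine ((HasFDerivAt.fun_sum fun i (_ : i ∈ Finset.univ) => h i).const_mul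
    (1 / (n : ℝ))).congr_fderiv ?_
  ext v
  simp only [map_neg, neg_apply, InnerProductSpace.toDual_apply_apply]
  rw [real_inner_comm, inner_weightedMean]
  simp only [smul_apply, sum_apply,
    neg_apply, innerSL_apply_apply, smul_eq_mul]
  rw [← mul_neg, ← Finset.sum_neg_distrib]
  congr 1
  refine Finset.sum_congr rfl fun i _ => ?_
  rw [real_inner_comm v, Pi.neg_apply]
  ring

theorem hasFDerivAt_exp_neg_netOutput (x : Signal d) (c : ℝ) (W : Params d) :
    HasFDerivAt (fun V => Real.exp (-(c * netOutput V x)))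
      (-(Real.exp (-(c * netOutput W x)) * c) • innerSL ℝ (netMap x W)) W := by
  refine ((hasFDerivAt_netOutput x W).const_mul c).neg.exp.congr_fderiv ?_
  ext v
  simp only [smul_apply, neg_apply, smul_eq_mul, Pi.neg_apply]
  ring

theorem gradient_netRisk (x : Fin n → Signal d) (y : Fin n → ℝ) (W : Params d) :
    gradient (netRisk x y) W = -netMap (weightedMean x y (predictor W)) W := by
  refine HasGradientAt.gradient (hasGradientAt_iff_hasFDerivAt.2 ?_)
  refine ((HasFDerivAt.fun_sum fun i (_ : i ∈ Finset.univ) =>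
    hasFDerivAt_exp_neg_netOutput (x i) (y i) W).const_mul (1 / (n : ℝ))).congr_fderiv ?_
  ext v
  rw [netMap_weightedMean]
  simp only [map_neg, neg_apply, InnerProductSpace.toDual_apply_apply,
    smul_apply, sum_apply, innerSL_apply_apply,
    smul_eq_mul, real_inner_smul_left, sum_inner, neg_mul, Finset.sum_neg_distrib, mul_neg]

/-- The first term is the convexity of the loss and is nonnegative. The second is the curvature of
the quadratic parametrization and can have either sign; both signs of the total are exploited
through suitable test directions `V`. -/
theorem inner_hessian (x : Fin n → Signal d) (y : Fin n → ℝ) (W V : Params d) :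
    inner ℝ V (hessian x y W V) =
      (1 / (n : ℝ)) * ∑ i, Real.exp (-(y i * netOutput W (x i))) *
        (y i * inner ℝ V (netMap (x i) W)) ^ 2 -
      2 * netOutput V (weightedMean x y (predictor W)) := by
  have h : HasFDerivAt (fun U : Params d => -((1 / (n : ℝ)) •
      ∑ i, (Real.exp (-(y i * netOutput U (x i))) * y i) • netMap (x i) U)) _ W :=
    ((HasFDerivAt.fun_sum fun i (_ : i ∈ Finset.univ) =>
      ((hasFDerivAt_exp_neg_netOutput (x i) (y i) W).mul_const (y i)).smul
        (netMap (x i)).hasFDerivAt).const_smul (1 / (n : ℝ))).neg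
  have hg : gradient (netRisk x y) = fun U : Params d => -((1 / (n : ℝ)) •
      ∑ i, (Real.exp (-(y i * netOutput U (x i))) * y i) • netMap (x i) U) :=
    funext fun U => by rw [gradient_netRisk, netMap_weightedMean]
  rw [hessian, hg, h.fderiv, ← inner_netMap_self, netMap_weightedMean]
  simp only [neg_apply, smul_apply,
    sum_apply, add_apply,
    ContinuousLinearMap.smulRight_apply, innerSL_apply_apply, smul_eq_mul, inner_neg_right,
    real_inner_smul_right, inner_sum, inner_add_right]
  rw [← mul_sub, ← Finset.sum_sub_distrib, ← mul_neg, ← Finset.sum_neg_distrib]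
  congr 1
  refine Finset.sum_congr rfl fun i _ => ?_
  rw [← real_inner_comm V (netMap (x i) W)]
  ring

/-! ### Growth of a single Fourier mode under the planar recursion. -/

theorem tendsto_atTop_of_add_mul_le {u s : ℕ → ℝ} {a : ℝ} (ha : 0 < a)
    (hS : Tendsto (fun T => ∑ t ∈ Finset.range T, s t) atTop atTop)
    (h : ∀ᶠ t in atTop, u t + a * s t ≤ u (t + 1)) : Tendsto u atTop atTop := by
  obtain ⟨T, hT⟩ := eventually_atTop.1 h
  have key : ∀ t ≥ T, u T - a * ∑ i ∈ Finset.range T, s i + a * ∑ i ∈ Finset.range t, s i ≤ u t := by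
    intro t ht
    induction t, ht using Nat.le_induction with
    | base => linarith
    | succ t ht ih =>
      rw [Finset.sum_range_succ, mul_add]
      linarith [hT t ht]
  exact tendsto_atTop_mono' _ (eventually_atTop.2 ⟨T, key⟩)
    (tendsto_atTop_add_const_left _ _ (hS.const_mul_atTop ha))

/-- Were the total step length finite, `1 + u ≤ exp u` would keep `N` bounded. -/
theorem tendsto_sum_atTop_of_growth {s N κ : ℕ → ℝ} {Λ : ℝ} (hs : ∀ t, 0 ≤ s t)
    (hN0 : ∀ t, 0 ≤ N t) (hN : Tendsto N atTop atTop) (hκ : Tendsto κ atTop (𝓝 0))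
    (hNs : ∀ t, N (t + 1) ≤ N t * (1 + s t * (Λ + κ t))) :
    Tendsto (fun T => ∑ t ∈ Finset.range T, s t) atTop atTop := by
  rw [← not_summable_iff_tendsto_nat_atTop_of_nonneg hs]
  intro hsum
  obtain ⟨K₀, hK₀⟩ := (hκ.const_add Λ).bddAbove_range
  set K := max K₀ 0
  have hK : ∀ t, Λ + κ t ≤ K := fun t => (hK₀ ⟨t, rfl⟩).trans (le_max_left _ _)
  have key : ∀ T, N T ≤ N 0 * Real.exp (K * ∑ t ∈ Finset.range T, s t) := by
    intro T
    induction T with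
    | zero => simp
    | succ T ih =>
      calc N (T + 1) ≤ N T * (1 + s T * (Λ + κ T)) := hNs T
        _ ≤ N T * Real.exp (K * s T) := by
          refine mul_le_mul_of_nonneg_left ?_ (hN0 T)
          have h1 := mul_le_mul_of_nonneg_left (hK T) (hs T)
          linarith [Real.add_one_le_exp (K * s T), mul_comm K (s T)]
        _ ≤ N 0 * Real.exp (K * ∑ t ∈ Finset.range T, s t) * Real.exp (K * s T) :=
          mul_le_mul_of_nonneg_right ih (Real.exp_pos _).le
        _ = _ := by rw [Finset.sum_range_succ, mul_add, Real.exp_add, mul_assoc]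
  obtain ⟨T, hT⟩ := (hN.eventually_gt_atTop (N 0 * Real.exp (K * ∑' t, s t))).exists
  refine absurd (key T) (not_le.2 (lt_of_le_of_lt ?_ hT))
  refine mul_le_mul_of_nonneg_left (Real.exp_le_exp.2 ?_) (hN0 0)
  exact mul_le_mul_of_nonneg_left (hsum.sum_le_tsum _ fun t _ => hs t) (le_max_right _ _)

/-- The first-order terms in `s` cancel: the imbalance between the layers is conserved by gradient
flow. A discrete step multiplies it by a factor that is positive when `s ‖c‖ < 1`, whatever the
phase of `c`, so it never vanishes if it is nonzero at the start. -/
theorem norm_sq_sub_norm_sq_step (p q c : ℂ) (s : ℝ) :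
    ‖p + s * (conj c * q)‖ ^ 2 - ‖q + s * (c * p)‖ ^ 2 =
      (‖p‖ ^ 2 - ‖q‖ ^ 2) * (1 - (s * ‖c‖) ^ 2) := by
  simp only [mul_pow, Complex.sq_norm, Complex.normSq_apply, Complex.add_re, Complex.add_im,
    Complex.mul_re, Complex.mul_im, Complex.conj_re, Complex.conj_im, Complex.ofReal_re,
    Complex.ofReal_im]
  ring

theorem norm_sq_add_norm_sq_step (p q c : ℂ) (s : ℝ) :
    ‖p + s * (conj c * q)‖ ^ 2 + ‖q + s * (c * p)‖ ^ 2 =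
      (‖p‖ ^ 2 + ‖q‖ ^ 2) * (1 + (s * ‖c‖) ^ 2) + 4 * s * (conj q * c * p).re := by
  simp only [mul_pow, Complex.sq_norm, Complex.normSq_apply, Complex.add_re, Complex.add_im,
    Complex.mul_re, Complex.mul_im, Complex.conj_re, Complex.conj_im, Complex.ofReal_re,
    Complex.ofReal_im]
  ring

theorem re_conj_mul_step (p q c C : ℂ) (s : ℝ) :
    (conj (q + s * (c * p)) * C * (p + s * (conj c * q))).re =
      (conj q * C * p).re + s * (C * conj c).re * (‖p‖ ^ 2 + ‖q‖ ^ 2) +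
        s ^ 2 * (conj p * (conj c ^ 2 * C) * q).re := by
  rw [Complex.sq_norm, Complex.sq_norm]
  simp only [pow_two, Complex.normSq_apply, Complex.add_re, Complex.add_im, Complex.mul_re,
    Complex.mul_im, Complex.conj_re, Complex.conj_im, Complex.ofReal_re, Complex.ofReal_im,
    map_add, map_mul, Complex.conj_ofReal]
  ring

theorem two_mul_abs_re_le (p q c : ℂ) :
    2 * |(conj q * c * p).re| ≤ ‖c‖ * (‖p‖ ^ 2 + ‖q‖ ^ 2) := by
  have h := Complex.abs_re_le_norm (conj q * c * p)
  rw [norm_mul, norm_mul, RCLike.norm_conj] at h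
  nlinarith [mul_nonneg (norm_nonneg c) (sq_nonneg (‖p‖ - ‖q‖))]

/-- One step of the dynamics, in terms of the energy `E = |p|² + |q|²` and the alignment
`Q = 2 Re (q̄ C p)`. -/
theorem alignment_step (p q c C : ℂ) {s ε : ℝ} (hs : 0 ≤ s)
    (hc : ‖c - C‖ ≤ ε * ‖C‖) (hsc : s * ‖c‖ ^ 2 ≤ ε * ‖C‖) :
    2 * (conj q * C * p).re + (2 - 3 * ε) * s * ‖C‖ ^ 2 * (‖p‖ ^ 2 + ‖q‖ ^ 2) ≤
      2 * (conj (q + s * (c * p)) * C * (p + s * (conj c * q))).re ∧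
    (‖p‖ ^ 2 + ‖q‖ ^ 2) + 2 * s * (2 * (conj q * C * p).re) -
        2 * ε * s * ‖C‖ * (‖p‖ ^ 2 + ‖q‖ ^ 2) ≤
      ‖p + s * (conj c * q)‖ ^ 2 + ‖q + s * (c * p)‖ ^ 2 := by
  have hE : 0 ≤ ‖p‖ ^ 2 + ‖q‖ ^ 2 := by positivity
  constructor
  · rw [re_conj_mul_step]
    have h1 : (C * conj c).re = ‖C‖ ^ 2 + (C * conj (c - C)).re := by
      simp only [Complex.sq_norm, Complex.normSq_apply, Complex.mul_re, Complex.conj_re,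
        Complex.conj_im, Complex.sub_re, Complex.sub_im, map_sub]
      ring
    have h2 : -(ε * ‖C‖ ^ 2) ≤ (C * conj (c - C)).re := by
      have := Complex.abs_re_le_norm (C * conj (c - C))
      rw [norm_mul, RCLike.norm_conj] at this
      have h3 := mul_le_mul_of_nonneg_left hc (norm_nonneg C)
      linarith [neg_abs_le (C * conj (c - C)).re, show ‖C‖ * (ε * ‖C‖) = ε * ‖C‖ ^ 2 by ring]
    have h4 := two_mul_abs_re_le q p (conj c ^ 2 * C)
    rw [norm_mul, norm_pow, RCLike.norm_conj] at h4
    have h5 : s ^ 2 * (‖c‖ ^ 2 * ‖C‖ * (‖q‖ ^ 2 + ‖p‖ ^ 2)) ≤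
        ε * s * ‖C‖ ^ 2 * (‖p‖ ^ 2 + ‖q‖ ^ 2) := by
      have := mul_le_mul_of_nonneg_right hsc
        (mul_nonneg (mul_nonneg hs (norm_nonneg C)) hE)
      linarith
    have h6 : s ^ 2 * (2 * (conj p * (conj c ^ 2 * C) * q).re) ≥
        -(s ^ 2 * (‖c‖ ^ 2 * ‖C‖ * (‖q‖ ^ 2 + ‖p‖ ^ 2))) := by
      rw [← mul_neg]
      refine mul_le_mul_of_nonneg_left ?_ (sq_nonneg s)
      linarith [neg_abs_le (conj p * (conj c ^ 2 * C) * q).re]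
    have h7 := mul_le_mul_of_nonneg_right h2 (mul_nonneg hs hE)
    rw [h1]
    linarith
  · rw [norm_sq_add_norm_sq_step]
    have h1 : (conj q * c * p).re = (conj q * C * p).re + (conj q * (c - C) * p).re := by
      rw [← Complex.add_re]
      congr 1
      ring
    have h2 := two_mul_abs_re_le p q (c - C)
    have h3 := mul_le_mul_of_nonneg_right hc hE
    have h4 : -(ε * ‖C‖ * (‖p‖ ^ 2 + ‖q‖ ^ 2)) ≤ 2 * (conj q * (c - C) * p).re := by
      linarith [neg_abs_le (conj q * (c - C) * p).re]
    have h5 := mul_le_mul_of_nonneg_left h4 hs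
    have h6 : 0 ≤ (‖p‖ ^ 2 + ‖q‖ ^ 2) * (s * ‖c‖) ^ 2 := by positivity
    rw [h1]
    linarith

/-- Consider the linear recursion `p ↦ p + s c̄ q`, `q ↦ q + s c p` with small steps and `c → C`.
If `|p| ≠ |q|` initially, then the energy `|p|² + |q|²` grows at least at the top rate `2 ‖C‖`. -/
theorem two_mul_norm_le_of_growth {s N κ : ℕ → ℝ} {c p q : ℕ → ℂ} {C : ℂ} {Λ : ℝ}
    (hC : C ≠ 0) (hs : ∀ t, 0 ≤ s t) (hs0 : Tendsto s atTop (𝓝 0)) (hc : Tendsto c atTop (𝓝 C))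
    (hp : ∀ t, p (t + 1) = p t + s t * (conj (c t) * q t))
    (hq : ∀ t, q (t + 1) = q t + s t * (c t * p t))
    (hsc : ∀ t, s t * ‖c t‖ < 1) (h0 : ‖p 0‖ ^ 2 ≠ ‖q 0‖ ^ 2)
    (hE : ∀ t, ‖p t‖ ^ 2 + ‖q t‖ ^ 2 ≤ N t) (hN : Tendsto N atTop atTop)
    (hκ : Tendsto κ atTop (𝓝 0)) (hNs : ∀ t, N (t + 1) ≤ N t * (1 + s t * (Λ + κ t))) :
    2 * ‖C‖ ≤ Λ := by
  by_contra! hlt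
  have hM : 0 < ‖C‖ := norm_pos_iff.2 hC
  set M := ‖C‖ with hMdef
  set E : ℕ → ℝ := fun t => ‖p t‖ ^ 2 + ‖q t‖ ^ 2 with hEdef
  set Q : ℕ → ℝ := fun t => 2 * (conj (q t) * C * p t).re with hQdef
  set D : ℕ → ℝ := fun t => |‖p t‖ ^ 2 - ‖q t‖ ^ 2| with hDdef
  have hE0 : ∀ t, 0 ≤ E t := fun t => by positivity
  have hS : Tendsto (fun T => ∑ t ∈ Finset.range T, s t) atTop atTop :=
    tendsto_sum_atTop_of_growth hs (fun t => (hE0 t).trans (hE t)) hN hκ hNs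
  have hsq : ∀ t, (s t * ‖c t‖) ^ 2 < 1 := fun t =>
    (sq_lt_one_iff₀ (mul_nonneg (hs t) (norm_nonneg _))).2 (hsc t)
  have hDstep : ∀ t, D (t + 1) = D t * (1 - (s t * ‖c t‖) ^ 2) := fun t => by
    simp only [hDdef]
    rw [hp, hq, norm_sq_sub_norm_sq_step, abs_mul, abs_of_pos (sub_pos.2 (hsq t))]
  have hD : ∀ t, 0 < D t := by
    intro t
    induction t with
    | zero => exact abs_pos.2 (sub_ne_zero.2 h0)
    | succ t ih => rw [hDstep]; exact mul_pos ih (sub_pos.2 (hsq t))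
  have hDE : ∀ t, D t ≤ E t := fun t =>
    abs_le.2 ⟨by simp only [hEdef]; linarith [sq_nonneg ‖p t‖],
      by simp only [hEdef]; linarith [sq_nonneg ‖q t‖]⟩
  have hQE : ∀ t, |Q t| ≤ M * E t := fun t => by
    have := two_mul_abs_re_le (p t) (q t) C
    simp only [hQdef, abs_mul, abs_two]
    exact this
  have hN0 : ∀ t, 0 < N t := fun t => (hD t).trans_le ((hDE t).trans (hE t))
  -- The gap between the rates is split in three: one share absorbs `κ`, one the errors of
  -- `alignment_step`, and one remains as net growth.
  set a := (2 * M - Λ) / 3 with ha_def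
  have ha : 0 < a := by rw [ha_def]; linarith
  set ε := min (1 / 3) (a / (5 * M)) with hε_def
  have hε : 0 < ε := by positivity
  have hε1 : ε ≤ 1 / 3 := min_le_left _ _
  have hε2 : 5 * ε * M ≤ a := by
    have := (le_div_iff₀ (by positivity)).1 (min_le_right (1 / 3) (a / (5 * M)))
    linarith
  have hev1 : ∀ᶠ t in atTop, ‖c t - C‖ ≤ ε * M := by
    have : Tendsto (fun t => ‖c t - C‖) atTop (𝓝 0) := by
      simpa using (hc.sub_const C).norm
    exact (this.eventually (gt_mem_nhds (mul_pos hε hM))).mono fun _ h => h.le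
  have hev2 : ∀ᶠ t in atTop, s t * ‖c t‖ ^ 2 ≤ ε * M := by
    have : Tendsto (fun t => s t * ‖c t‖ ^ 2) atTop (𝓝 0) := by
      simpa using hs0.mul (hc.norm.pow 2)
    exact (this.eventually (gt_mem_nhds (mul_pos hε hM))).mono fun _ h => h.le
  have hstep : ∀ᶠ t in atTop, s t * ‖c t‖ ^ 2 ≤ ε * M ∧
      Q t + s t * M ^ 2 * E t ≤ Q (t + 1) ∧
      M * E t + Q t + 2 * s t * M * (M * E t + Q t) - 5 * ε * s t * M ^ 2 * E t ≤
        M * E (t + 1) + Q (t + 1) := by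
    filter_upwards [hev1, hev2] with t h1 h2
    obtain ⟨h3, h4⟩ := alignment_step (p t) (q t) (c t) C (hs t) h1 h2
    rw [← hp, ← hq] at h3 h4
    have h5 : 0 ≤ s t * M ^ 2 * E t := mul_nonneg (mul_nonneg (hs t) (sq_nonneg M)) (hE0 t)
    have h6 := mul_le_mul_of_nonneg_left h4 hM.le
    refine ⟨h2, ?_, ?_⟩
    · have := mul_nonneg (show 0 ≤ 1 - 3 * ε by linarith) h5
      simp only [hQdef, hEdef] at *
      linarith
    · simp only [hQdef, hEdef] at *
      linarith
  -- The imbalance `D` does not increase, while each step adds at least `s M² E ≥ s M² D` to `Q`.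
  -- The rate keeps half of this gain; the rest pays for the shrinking of `D` when `Q` is negative.
  have hR : Tendsto (fun t => Q t / D t) atTop atTop := by
    refine tendsto_atTop_of_add_mul_le (a := M ^ 2 / 2) (by positivity) hS ?_
    filter_upwards [hstep] with t ⟨h2, h3, _⟩
    rw [le_div_iff₀ (hD _)]
    have h4 : (Q t / D t + M ^ 2 / 2 * s t) * D (t + 1) =
        Q t - Q t * (s t * ‖c t‖) ^ 2 + M ^ 2 / 2 * s t * D (t + 1) := by
      rw [hDstep]
      field_simp [(hD t).ne']
    have h5 : D (t + 1) ≤ E t := by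
      rw [hDstep]
      refine le_trans ?_ (hDE t)
      exact mul_le_of_le_one_right (hD t).le (by linarith [sq_nonneg (s t * ‖c t‖)])
    have h6 : -(M * E t) ≤ Q t := (abs_le.1 (hQE t)).1
    have h7 := mul_le_mul_of_nonneg_right h6 (sq_nonneg (s t * ‖c t‖))
    have h8 : M * E t * (s t * ‖c t‖) ^ 2 ≤ ε * (s t * M ^ 2 * E t) := by
      have := mul_le_mul_of_nonneg_left h2 (mul_nonneg (mul_nonneg hM.le (hE0 t)) (hs t))
      linarith
    have h9 := mul_le_mul_of_nonneg_left h5 (mul_nonneg (show 0 ≤ M ^ 2 / 2 by positivity) (hs t))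
    have h10 : 0 ≤ s t * M ^ 2 * E t := mul_nonneg (mul_nonneg (hs t) (sq_nonneg M)) (hE0 t)
    have h11 := mul_le_mul_of_nonneg_right hε1 h10
    rw [h4]
    linarith
  have hQpos : ∀ᶠ t in atTop, 0 ≤ Q t := by
    filter_upwards [hR.eventually_ge_atTop 0] with t ht
    simpa using (le_div_iff₀ (hD t)).1 ht
  have hev3 : ∀ᶠ t in atTop, N (t + 1) ≤ N t * (1 + s t * (Λ + a)) ∧ N (t + 1) ≤ 2 * N t := by
    have h1 : Tendsto (fun t => s t * (Λ + κ t)) atTop (𝓝 0) := by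
      simpa using hs0.mul (hκ.const_add Λ)
    filter_upwards [hκ.eventually (gt_mem_nhds ha), h1.eventually (gt_mem_nhds one_pos)]
      with t h2 h3
    refine ⟨(hNs t).trans (mul_le_mul_of_nonneg_left ?_ (hN0 t).le), (hNs t).trans ?_⟩
    · have := mul_le_mul_of_nonneg_left h2.le (hs t)
      linarith
    · have := mul_le_mul_of_nonneg_left h3.le (hN0 t).le
      linarith
  -- Here `M E + Q = M |q + (C / M) p|²` is, up to a constant, the energy along the expanding
  -- eigenvector. Its share of `N` is bounded by `2 M`, yet it would diverge if `Λ < 2 M`.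
  set Φ : ℕ → ℝ := fun t => (M * E t + Q t) / N t with hΦ_def
  have hΦstep : ∀ᶠ t in atTop, 0 < Φ t ∧ Φ t + Φ t * a / 2 * s t ≤ Φ (t + 1) := by
    filter_upwards [hstep, hQpos, hev3] with t ⟨_, _, h1⟩ h2 ⟨h3, h4⟩
    have hG : 0 < M * E t + Q t := by
      have := mul_pos hM ((hD t).trans_le (hDE t))
      linarith
    have hΦ : 0 < Φ t := div_pos hG (hN0 t)
    refine ⟨hΦ, ?_⟩
    rw [hΦ_def]
    simp only []
    rw [le_div_iff₀ (hN0 _)]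
    have hGN : M * E t + Q t = Φ t * N t := (div_mul_cancel₀ _ (hN0 t).ne').symm
    have h5 : 5 * ε * s t * M ^ 2 * E t ≤ a * s t * (M * E t + Q t) := by
      have h6 : 0 ≤ s t * (M * E t) := mul_nonneg (hs t) (mul_nonneg hM.le (hE0 t))
      have h7 := mul_le_mul_of_nonneg_right hε2 h6
      have h8 := mul_nonneg (mul_nonneg ha.le (hs t)) h2
      linarith
    have h9 := mul_le_mul_of_nonneg_left h3 hΦ.le
    have h10 := mul_le_mul_of_nonneg_left h4
      (mul_nonneg (mul_nonneg hΦ.le (half_pos ha).le) (hs t))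
    have h11 : 2 * M = Λ + 3 * a := by rw [ha_def]; ring
    change (Φ t + Φ t * a / 2 * s t) * N (t + 1) ≤ _
    refine le_trans ?_ h1
    have h12 : 2 * s t * M * (M * E t + Q t) = s t * (Λ + 3 * a) * (M * E t + Q t) := by
      rw [← h11]; ring
    rw [h12]
    rw [hGN] at h5 ⊢
    linarith
  obtain ⟨T, hT⟩ := eventually_atTop.1 hΦstep
  have hmono : ∀ t ≥ T, Φ T ≤ Φ t := by
    intro t ht
    induction t, ht using Nat.le_induction with
    | base => exact le_rfl
    | succ t ht ih =>
      have h1 := hT t ht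
      have h2 := mul_nonneg (div_nonneg (mul_nonneg h1.1.le ha.le) zero_le_two) (hs t)
      linarith
  have hΦinf : Tendsto Φ atTop atTop := by
    refine tendsto_atTop_of_add_mul_le (a := Φ T * a / 2)
      (half_pos (mul_pos (hT T le_rfl).1 ha)) hS ?_
    filter_upwards [eventually_ge_atTop T] with t ht
    have h1 := mul_le_mul_of_nonneg_right (hmono t ht) (mul_nonneg (half_pos ha).le (hs t))
    linarith [(hT t ht).2]
  obtain ⟨t, ht⟩ := (hΦinf.eventually_gt_atTop (2 * M)).exists
  rw [hΦ_def] at ht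
  simp only [] at ht
  rw [lt_div_iff₀ (hN0 t)] at ht
  have h1 := mul_le_mul_of_nonneg_left (hE t) hM.le
  have h2 := (abs_le.1 (hQE t)).2
  simp only [hEdef] at *
  linarith

/-! ### Robust radius and its dual certificate. -/

theorem params_norm_sq (W : Params d) : ‖W‖ ^ 2 = ‖W.fst‖ ^ 2 + ‖W.snd‖ ^ 2 :=
  WithLp.prod_norm_sq_eq_of_L2 W

theorem fourier_neg (w : Signal d) (k : ZMod d) : fourier (-w) k = -fourier w k := by
  have := fourier_smul (-1) w k
  simpa using this

theorem norm_circConv_le {w δ : Signal d} (hδ : ‖fourier δ‖ ≤ 1) : ‖circConv w δ‖ ≤ ‖w‖ := by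
  refine le_of_sq_le_sq ?_ (norm_nonneg _)
  rw [← sum_norm_sq_fourier, ← sum_norm_sq_fourier]
  refine Finset.sum_le_sum fun k _ => ?_
  rw [fourier_circConv, norm_mul]
  refine pow_le_pow_left₀ (by positivity) ?_ 2
  exact mul_le_of_le_one_right (norm_nonneg _) ((norm_le_pi_norm _ k).trans hδ)

/-- Pairing with the optimal dual signal `δ` gives `w₂ᵀ (w₁ ⋆ δ) ≤ ‖w₂‖ ‖w₁‖`, as convolution by `δ`
is a contraction; AM-GM finishes. -/
theorem two_mul_fourierL1_predictor_le (W : Params d) :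
    2 * fourierL1 (predictor W) ≤ ‖W‖ ^ 2 := by
  obtain ⟨δ, hδ, h⟩ := exists_inner_eq_fourierL1 (predictor W)
  rw [← h, ← netOutput_eq_inner, netOutput, params_norm_sq]
  have h1 := real_inner_le_norm W.snd (circConv W.fst δ)
  have h2 := mul_le_mul_of_nonneg_left (norm_circConv_le (w := W.fst) hδ) (norm_nonneg W.snd)
  linarith [sq_nonneg (‖W.snd‖ - ‖W.fst‖)]

theorem fourierL1_nonneg (w : Signal d) : 0 ≤ fourierL1 w :=
  Finset.sum_nonneg fun _ _ => norm_nonneg _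

theorem abs_inner_le_norm_fourier_mul (w z : Signal d) :
    |inner ℝ w z| ≤ ‖fourier z‖ * fourierL1 w := by
  refine abs_le'.2 ⟨inner_le_of_norm_fourier_le fun k => norm_le_pi_norm _ k, ?_⟩
  rw [← inner_neg_right]
  refine inner_le_of_norm_fourier_le fun k => ?_
  rw [fourier_neg, norm_neg]
  exact norm_le_pi_norm _ k

/-- The worst perturbation is `ε` times the dual optimizer, with sign opposite to the label. -/
theorem RobustAt.mul_fourierL1_le {x : Fin n → Signal d} {y : Fin n → ℝ}
    (hy : ∀ i, y i = 1 ∨ y i = -1) {W : Params d} {ε : ℝ≥0} (h : RobustAt x y W ε) (i : Fin n) :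
    ε * fourierL1 (predictor W) ≤ y i * inner ℝ (predictor W) (x i) := by
  obtain ⟨δ, hδ, hδ'⟩ := exists_inner_eq_fourierL1 (predictor W)
  have hε : ‖fourier ((ε : ℝ) • δ)‖ ≤ ε := by
    rw [norm_fourier_smul ε.coe_nonneg]
    exact mul_le_of_le_one_right ε.coe_nonneg hδ
  have hneg : ‖fourier (-((ε : ℝ) • δ))‖ ≤ ε := by
    have : fourier (-((ε : ℝ) • δ)) = -fourier ((ε : ℝ) • δ) := funext fun k => fourier_neg _ k
    rw [this, norm_neg]
    exact hε
  rcases hy i with hi | hi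
  · have := h i _ hneg
    rw [netOutput_eq_inner, inner_add_right, inner_neg_right, real_inner_smul_right, hδ', hi] at this
    rw [hi]
    linarith
  · have := h i _ hε
    rw [netOutput_eq_inner, inner_add_right, real_inner_smul_right, hδ', hi] at this
    rw [hi]
    linarith

theorem robustAt_of_mul_fourierL1_lt {x : Fin n → Signal d} {y : Fin n → ℝ}
    (hy : ∀ i, y i = 1 ∨ y i = -1) {W : Params d} {ε : ℝ≥0}
    (h : ∀ i, ε * fourierL1 (predictor W) < y i * netOutput W (x i)) : RobustAt x y W ε := by
  intro i δ hδ
  have h1 := (abs_inner_le_norm_fourier_mul (predictor W) δ).trans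
    (mul_le_mul_of_nonneg_right hδ (fourierL1_nonneg _))
  rw [netOutput_add, netOutput_eq_inner W δ]
  have h2 := abs_le.1 h1
  have h3 := h i
  rcases hy i with hi | hi <;> rw [hi] at h3 ⊢ <;> linarith [h2.1, h2.2]

/-- A dual certificate for maximal robustness. -/
theorem isMaximallyRobust_of_certificate {x : Fin n → Signal d} {y : Fin n → ℝ} (hn : 0 < n)
    (hy : ∀ i, y i = 1 ∨ y i = -1) {V : Params d} {Z : Signal d} {γ : ℝ}
    (hV : ‖V‖ = 1) (hγ : ∀ i, γ ≤ y i * netOutput V (x i))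
    (hZ : ∀ k, ‖fourier Z k‖ ≤ 2 * netOutput V Z) (hpos : 0 < netOutput V Z)
    (hdual : ∀ (β : Signal d) (r : ℝ), 0 ≤ r → (∀ i, r ≤ y i * inner ℝ β (x i)) →
      r * netOutput V Z ≤ γ * inner ℝ β Z) (hγ0 : 0 < γ) :
    IsMaximallyRobust x y V := by
  have hL1 : 2 * fourierL1 (predictor V) ≤ 1 := by
    simpa [hV] using two_mul_fourierL1_predictor_le V
  intro W
  refine iSup₂_le fun ε hε => ?_
  -- A zero predictor fails already at the perturbation `0`.
  have hβ0 : 0 < fourierL1 (predictor W) := by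
    refine (fourierL1_nonneg _).lt_of_ne fun h0 => ?_
    have h1 := hε ⟨0, hn⟩ 0 (by
      have : fourier (0 : Signal d) = 0 := funext fun k => by simp [fourier_apply]
      rw [this, norm_zero]
      exact ε.coe_nonneg)
    have h2 := abs_inner_le_norm_fourier_mul (predictor W) (x ⟨0, hn⟩)
    rw [← h0, mul_zero] at h2
    rw [add_zero, netOutput_eq_inner, abs_nonpos_iff.1 h2, mul_zero] at h1
    exact lt_irrefl _ h1
  have hε2 : (ε : ℝ) ≤ 2 * γ := by
    have h1 := hdual (predictor W) _ (mul_nonneg ε.coe_nonneg (fourierL1_nonneg _))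
      (hε.mul_fourierL1_le hy)
    have h2 := mul_le_mul_of_nonneg_left (inner_le_of_norm_fourier_le (w := predictor W) hZ)
      hγ0.le
    have h3 := mul_pos hβ0 hpos
    refine le_of_mul_le_mul_right ?_ h3
    linarith
  -- Robustness is a strict condition and may fail at the extremal radius, so only radii below `ε`
  -- are compared.
  refine le_of_forall_lt fun r hr => ?_
  obtain ⟨r', hr', hr''⟩ := ENNReal.lt_iff_exists_nnreal_btwn.1 hr
  refine hr'.trans_le (le_iSup₂_of_le r' (robustAt_of_mul_fourierL1_lt hy fun i => ?_) le_rfl)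
  have h1 : (r' : ℝ) < ε := NNReal.coe_lt_coe.2 (ENNReal.coe_lt_coe.1 hr'')
  have h2 := mul_le_mul_of_nonneg_left hL1 r'.coe_nonneg
  refine lt_of_lt_of_le ?_ (hγ i)
  linarith

theorem IsMaximallyRobust.smul {x : Fin n → Signal d} {y : Fin n → ℝ} {V : Params d}
    (h : IsMaximallyRobust x y V) {c : ℝ} (hc : c ≠ 0) : IsMaximallyRobust x y (c • V) := by
  have h1 : ∀ ε, RobustAt x y (c • V) ε ↔ RobustAt x y V ε := fun ε => by
    refine forall_congr' fun i => forall_congr' fun δ => imp_congr_right fun _ => ?_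
    rw [netOutput_smul_left, mul_left_comm]
    exact mul_pos_iff_of_pos_left (by positivity)
  intro W
  simpa only [robustRadius, h1] using h W

/-! ### Comparison of risk, gradient and Hessian. -/

theorem linearRisk_predictor (x : Fin n → Signal d) (y : Fin n → ℝ) (W : Params d) :
    linearRisk x y (predictor W) = netRisk x y W := by
  simp only [linearRisk, netRisk, netOutput_eq_inner]

theorem norm_weightedMean_le (x : Fin n → Signal d) {y : Fin n → ℝ}
    (hy : ∀ i, y i = 1 ∨ y i = -1) (w : Signal d) :
    ‖weightedMean x y w‖ ≤ (∑ i, ‖x i‖) * linearRisk x y w := by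
  rw [weightedMean, linearRisk, norm_smul, Real.norm_of_nonneg (by positivity), mul_left_comm]
  refine mul_le_mul_of_nonneg_left ?_ (by positivity)
  rw [Finset.mul_sum]
  refine norm_sum_le_of_le _ fun i _ => ?_
  have h1 : |y i| = 1 := by rcases hy i with h | h <;> simp [h]
  rw [norm_smul, norm_mul, Real.norm_eq_abs (y i), h1, mul_one, Real.norm_of_nonneg
    (Real.exp_pos _).le, mul_comm]
  exact mul_le_mul_of_nonneg_right
    (Finset.single_le_sum (f := fun i => ‖x i‖) (fun _ _ => norm_nonneg _) (Finset.mem_univ i))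
    (Real.exp_pos _).le

theorem mul_linearRisk_le_inner_weightedMean {x : Fin n → Signal d} {y : Fin n → ℝ}
    {v : Signal d} {r : ℝ} (h : ∀ i, r ≤ y i * inner ℝ v (x i)) (w : Signal d) :
    r * linearRisk x y w ≤ inner ℝ v (weightedMean x y w) := by
  rw [inner_weightedMean, linearRisk, mul_left_comm, Finset.mul_sum]
  refine mul_le_mul_of_nonneg_left (Finset.sum_le_sum fun i _ => ?_) (by positivity)
  rw [mul_comm]
  exact mul_le_mul_of_nonneg_left (h i) (Real.exp_pos _).le

theorem inner_hessian_le (x : Fin n → Signal d) (y : Fin n → ℝ) (W V : Params d) :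
    inner ℝ V (hessian x y W V) ≤ ‖hessian x y W‖ * ‖V‖ ^ 2 := by
  refine (real_inner_le_norm _ _).trans ?_
  have := mul_le_mul_of_nonneg_left ((hessian x y W).le_opNorm V) (norm_nonneg V)
  linarith

/-- The negative curvature of the output layer bounds the Fourier coefficients of the gradient
with respect to the linear predictor. -/
theorem norm_fourier_weightedMean_le (x : Fin n → Signal d) (y : Fin n → ℝ) (W : Params d)
    (k : ZMod d) :
    ‖fourier (weightedMean x y (predictor W)) k‖ ≤ ‖hessian x y W‖ := by
  set z := weightedMean x y (predictor W) with hz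
  set h := ‖hessian x y W‖ with hh
  have hh0 : 0 ≤ h := norm_nonneg _
  have key : ∀ V : Params d, -(2 * netOutput V z) ≤ h * ‖V‖ ^ 2 := fun V => by
    refine le_trans ?_ (inner_hessian_le x y W V)
    rw [inner_hessian, ← hz]
    have : 0 ≤ (1 / (n : ℝ)) * ∑ i, Real.exp (-(y i * netOutput W (x i))) *
        (y i * inner ℝ V (netMap (x i) W)) ^ 2 := by positivity
    linarith
  refine norm_fourier_le_of_circConv (fun w => ?_) hh0 k
  have key2 : ∀ r : ℝ, 2 * r * ‖circConv w z‖ ^ 2 ≤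
      h * (‖w‖ ^ 2 + r ^ 2 * ‖circConv w z‖ ^ 2) := fun r => by
    -- For this direction the output on `z` is `-r ‖w ⋆ z‖²`, so the parametrization term is
    -- positive. The choice `r = 1 / h` then gives the sharp bound; `h = 0` is treated apart.
    have h1 := key (WithLp.toLp 2 (w, -(r • circConv w z)))
    rw [params_norm_sq, netOutput] at h1
    change -(2 * inner ℝ (-(r • circConv w z)) (circConv w z)) ≤
      h * (‖w‖ ^ 2 + ‖-(r • circConv w z)‖ ^ 2) at h1
    rw [inner_neg_left, real_inner_smul_left, real_inner_self_eq_norm_sq, norm_neg, norm_smul,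
      mul_pow, Real.norm_eq_abs, sq_abs] at h1
    linarith
  rcases hh0.eq_or_lt with h0 | h0
  · have := key2 1
    rw [← h0] at this ⊢
    linarith
  · have h1 := key2 h⁻¹
    have h2 := mul_le_mul_of_nonneg_left h1 h0.le
    have h3 : h * (2 * h⁻¹ * ‖circConv w z‖ ^ 2) = 2 * ‖circConv w z‖ ^ 2 := by
      field_simp
    have h4 : h * (h * (‖w‖ ^ 2 + h⁻¹ ^ 2 * ‖circConv w z‖ ^ 2)) =
        h ^ 2 * ‖w‖ ^ 2 + ‖circConv w z‖ ^ 2 := by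
      field_simp
    rw [h3, h4] at h2
    linarith

/-- Radial curvature of the risk at weights with large margins. -/
theorem netRisk_mul_le_norm_hessian (x : Fin n → Signal d) (y : Fin n → ℝ) {W : Params d} {c : ℝ}
    (hc : 0 < c) (hcW : 1 ≤ c * ‖W‖ ^ 2) (h : ∀ i, c * ‖W‖ ^ 2 ≤ y i * netOutput W (x i)) :
    2 * c ^ 2 * ‖W‖ ^ 2 * netRisk x y W ≤ ‖hessian x y W‖ := by
  have hN : 0 < ‖W‖ ^ 2 := by
    by_contra! h0
    linarith [mul_nonpos_of_nonneg_of_nonpos hc.le h0]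
  refine le_of_mul_le_mul_right (le_trans ?_ (inner_hessian_le x y W W)) hN
  rw [inner_hessian, netOutput_eq_inner, inner_weightedMean, netRisk]
  have : ∀ i, 2 * (c * ‖W‖ ^ 2) ^ 2 * Real.exp (-(y i * netOutput W (x i))) ≤
      Real.exp (-(y i * netOutput W (x i))) * (y i * inner ℝ W (netMap (x i) W)) ^ 2 -
      2 * (Real.exp (-(y i * netOutput W (x i))) * (y i * netOutput W (x i))) := fun i => by
    rw [inner_netMap_self]
    set m := y i * netOutput W (x i) with hm
    have h1 : y i * (2 * netOutput W (x i)) = 2 * m := by rw [hm]; ring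
    -- Since `m ≥ 1`, the convex part `4 m²` outweighs the negative part `2 m` and leaves at least
    -- `2 m²`.
    have h2 : 2 * (c * ‖W‖ ^ 2) ^ 2 ≤ (2 * m) ^ 2 - 2 * m := by
      have h3 := h i
      have h4 : (c * ‖W‖ ^ 2) ^ 2 ≤ m ^ 2 := pow_le_pow_left₀ (by linarith) h3 2
      have h5 : m ≤ m ^ 2 := by
        rw [pow_two]; exact le_mul_of_one_le_left (by linarith) (by linarith)
      linarith
    rw [h1]
    have h3 := mul_le_mul_of_nonneg_left h2 (Real.exp_pos (-m)).le
    linarith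
  have h1 := mul_le_mul_of_nonneg_left (Finset.sum_le_sum fun i (_ : i ∈ Finset.univ) => this i)
    (show 0 ≤ 1 / (n : ℝ) by positivity)
  rw [Finset.sum_sub_distrib, ← Finset.mul_sum, ← Finset.mul_sum] at h1
  simp only [← netOutput_eq_inner]
  linarith

/-! ### Generic initializations. -/

/-- A unit impulse has a nonzero coefficient at every frequency. Along lines that add multiples of
it to the first layer, equality is a genuine quadratic equation with finitely many roots; slicing
along these lines gives a null set. -/
theorem ae_norm_fourier_ne (d : ℕ) [NeZero d] : ∀ᵐ W : Params d, ∀ k,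
    ‖fourier W.fst k‖ ^ 2 ≠ ‖fourier W.snd k‖ ^ 2 := by
  refine ae_all_iff.2 fun k => ?_
  let e : Params d := WithLp.toLp 2 (EuclideanSpace.single 0 1, 0)
  let L : ℝ →ₗ[ℝ] Params d := LinearMap.toSpanSingleton ℝ (Params d) e
  have hc1 : Continuous fun W : Params d => ‖fourier W.fst k‖ ^ 2 :=
    ((continuous_fourier_apply k).comp (WithLp.fstL 2 ℝ (Signal d) (Signal d)).continuous).norm.pow 2
  have hc2 : Continuous fun W : Params d => ‖fourier W.snd k‖ ^ 2 :=
    ((continuous_fourier_apply k).comp (WithLp.sndL 2 ℝ (Signal d) (Signal d)).continuous).norm.pow 2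
  refine ae_mem_of_ae_add_linearMap_mem L volume volume
    (s := {W : Params d | ‖fourier W.fst k‖ ^ 2 ≠ ‖fourier W.snd k‖ ^ 2})
    (isOpen_ne_fun hc1 hc2).measurableSet fun W => ?_
  set a : ℝ := 1 / √(d : ℝ) with ha
  have ha0 : a ≠ 0 := by
    have : (0 : ℝ) < d := Nat.cast_pos.2 (NeZero.pos d)
    positivity
  let P : Polynomial ℝ := Polynomial.C (a ^ 2) * Polynomial.X ^ 2 +
    Polynomial.C (2 * a * (fourier W.fst k).re) * Polynomial.X +
    Polynomial.C (‖fourier W.fst k‖ ^ 2 - ‖fourier W.snd k‖ ^ 2)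
  have hP : P ≠ 0 := fun h0 => by
    have h1 := Polynomial.degree_quadratic (a := a ^ 2) (b := 2 * a * (fourier W.fst k).re)
      (c := ‖fourier W.fst k‖ ^ 2 - ‖fourier W.snd k‖ ^ 2) (pow_ne_zero 2 ha0)
    change P.degree = 2 at h1
    rw [h0, Polynomial.degree_zero] at h1
    exact absurd h1 (by decide)
  have hfin : {r : ℝ | P.IsRoot r}.Finite := Polynomial.finite_setOfPred_isRoot hP
  refine measure_mono_null (fun r hr => ?_) (hfin.measure_zero volume)
  simp only [Set.mem_compl_iff, Set.mem_ofPred_eq, not_not] at hr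
  have h1 : (W + L r).fst = W.fst + r • EuclideanSpace.single 0 1 := rfl
  have h2 : (W + L r).snd = W.snd := by
    change W.snd + r • (0 : Signal d) = W.snd
    simp
  rw [h1, h2, fourier_add, fourier_smul, fourier_single_zero, ← ha] at hr
  have h3 : ‖fourier W.fst k + (r : ℂ) * (a : ℂ)‖ ^ 2 =
      ‖fourier W.fst k‖ ^ 2 + 2 * a * (fourier W.fst k).re * r + a ^ 2 * r ^ 2 := by
    simp only [Complex.sq_norm, Complex.normSq_apply, Complex.add_re, Complex.add_im,
      Complex.mul_re, Complex.mul_im, Complex.ofReal_re, Complex.ofReal_im]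
    ring
  rw [h3] at hr
  simp only [Set.mem_ofPred_eq, Polynomial.IsRoot.def, P, Polynomial.eval_add, Polynomial.eval_mul,
    Polynomial.eval_C, Polynomial.eval_pow, Polynomial.eval_X]
  linarith

/-! ### Limit directions of weights and gradients, and the conclusion. -/

/-- Averages with the weights `exp (-N μ)` concentrate on the minimizers as `N → ∞`. -/
theorem tendsto_softmin_average {ι : Type*} [Fintype ι] {N : ℕ → ℝ} {μ : ℕ → ι → ℝ} {γ : ι → ℝ}
    (hN : Tendsto N atTop atTop) (hμ : ∀ i, Tendsto (fun t => μ t i) atTop (𝓝 (γ i))) (i₀ : ι)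
    (hmin : ∀ i, γ i₀ ≤ γ i) :
    Tendsto (fun t => (∑ i, Real.exp (-(N t * μ t i)) * γ i) / ∑ i, Real.exp (-(N t * μ t i)))
      atTop (𝓝 (γ i₀)) := by
  have hS : ∀ t, 0 < ∑ i, Real.exp (-(N t * μ t i)) := fun t =>
    Finset.sum_pos (fun i _ => Real.exp_pos _) ⟨i₀, Finset.mem_univ _⟩
  have h1 : ∀ t, (∑ i, Real.exp (-(N t * μ t i)) * γ i) / ∑ i, Real.exp (-(N t * μ t i)) =
      γ i₀ + ∑ i, Real.exp (-(N t * μ t i)) / (∑ i, Real.exp (-(N t * μ t i))) *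
        (γ i - γ i₀) := fun t => by
    simp only [mul_sub, Finset.sum_sub_distrib, ← Finset.sum_mul, ← Finset.sum_div, div_mul_eq_mul_div]
    rw [mul_div_cancel_left₀ _ (hS t).ne']
    ring
  simp only [h1]
  have h2 : ∀ i, Tendsto (fun t => Real.exp (-(N t * μ t i)) /
      (∑ i, Real.exp (-(N t * μ t i))) * (γ i - γ i₀)) atTop (𝓝 0) := fun i => by
    rcases (hmin i).eq_or_lt with h | h
    · simp [h]
    · have h3 : Tendsto (fun t => Real.exp (-(N t * (μ t i - μ t i₀)))) atTop (𝓝 0) :=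
        Real.tendsto_exp_neg_atTop_nhds_zero.comp
          (hN.atTop_mul_pos (sub_pos.2 h) ((hμ i).sub (hμ i₀)))
      have h4 : Tendsto (fun t => Real.exp (-(N t * μ t i)) /
          ∑ i, Real.exp (-(N t * μ t i))) atTop (𝓝 0) := by
        refine squeeze_zero (fun t => div_nonneg (Real.exp_pos _).le (hS t).le) (fun t => ?_) h3
        rw [div_le_iff₀ (hS t)]
        have h5 : Real.exp (-(N t * μ t i)) =
            Real.exp (-(N t * (μ t i - μ t i₀))) * Real.exp (-(N t * μ t i₀)) := by
          rw [← Real.exp_add]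
          congr 1
          ring
        rw [h5]
        exact mul_le_mul_of_nonneg_left
          (Finset.single_le_sum (f := fun i => Real.exp (-(N t * μ t i)))
            (fun _ _ => (Real.exp_pos _).le) (Finset.mem_univ i₀)) (Real.exp_pos _).le
      simpa using h4.mul_const (γ i - γ i₀)
  simpa using (tendsto_finsetSum Finset.univ fun i _ => h2 i).const_add (γ i₀)

theorem netRisk_pos (hn : 0 < n) (x : Fin n → Signal d) (y : Fin n → ℝ) (W : Params d) :
    0 < netRisk x y W := by
  have : 0 < ∑ i, Real.exp (-(y i * netOutput W (x i))) :=
    Finset.sum_pos (fun i _ => Real.exp_pos _) ⟨⟨0, hn⟩, Finset.mem_univ _⟩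
  rw [netRisk]
  positivity

/-- A margin is at most a constant times `‖W‖²`, so bounded weights keep the risk away from zero. -/
theorem tendsto_norm_sq_atTop (hn : 0 < n) {x : Fin n → Signal d} {y : Fin n → ℝ}
    (hy : ∀ i, y i = 1 ∨ y i = -1) {W : ℕ → Params d}
    (hL : Tendsto (fun t => netRisk x y (W t)) atTop (𝓝 0)) :
    Tendsto (fun t => ‖W t‖ ^ 2) atTop atTop := by
  set i₀ : Fin n := ⟨0, hn⟩
  set K := 1 / 2 * ‖netMap (x i₀)‖ with hK
  have hn' : (0 : ℝ) < n := Nat.cast_pos.2 hn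
  have h1 : ∀ V : Params d, y i₀ * netOutput V (x i₀) ≤ K * ‖V‖ ^ 2 := fun V => by
    have h2 := abs_real_inner_le_norm V (netMap (x i₀) V)
    have h3 := mul_le_mul_of_nonneg_left ((netMap (x i₀)).le_opNorm V) (norm_nonneg V)
    rw [inner_netMap_self] at h2
    have h4 := abs_le.1 (h2.trans h3)
    rcases hy i₀ with h | h <;> rw [h, hK] <;> linarith [h4.1, h4.2]
  refine tendsto_atTop.2 fun B => ?_
  have hpos : 0 < 1 / (n : ℝ) * Real.exp (-(K * B)) := by positivity
  filter_upwards [hL.eventually (gt_mem_nhds hpos)] with t ht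
  have h2 : 1 / (n : ℝ) * Real.exp (-(y i₀ * netOutput (W t) (x i₀))) ≤ netRisk x y (W t) :=
    mul_le_mul_of_nonneg_left (Finset.single_le_sum
      (f := fun i => Real.exp (-(y i * netOutput (W t) (x i))))
      (fun _ _ => (Real.exp_pos _).le) (Finset.mem_univ i₀)) (by positivity)
  have h3 := lt_of_mul_lt_mul_left (h2.trans_lt ht) (by positivity)
  have h4 := neg_lt_neg_iff.1 (Real.exp_lt_exp.1 h3)
  exact (lt_of_mul_lt_mul_left (h4.trans_le (h1 _)) (by positivity)).le

/-- The relative growth of `‖W‖²` is expressed through the direction of `W` alone, so that it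
converges along the iterates. -/
theorem norm_sq_add_smul_netMap (W : Params d) (Z : Signal d) (s : ℝ) :
    ‖W + s • netMap Z W‖ ^ 2 = ‖W‖ ^ 2 * (1 + s * (4 * netOutput (‖W‖⁻¹ • W) Z +
      s * ‖netMap Z (‖W‖⁻¹ • W)‖ ^ 2)) := by
  rcases eq_or_ne W 0 with rfl | hW
  · simp
  · have h0 : ‖W‖ ≠ 0 := norm_ne_zero_iff.2 hW
    rw [norm_add_sq_real, real_inner_smul_right, inner_netMap_self, netOutput_smul_left, map_smul,
      norm_smul, norm_smul, norm_inv, norm_norm, mul_pow, mul_pow, Real.norm_eq_abs, sq_abs]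
    field_simp
    ring

theorem norm_fourier_apply_le (z : Signal d) (k : ZMod d) : ‖fourier z k‖ ≤ ‖z‖ := by
  refine le_of_sq_le_sq ?_ (norm_nonneg z)
  rw [← sum_norm_sq_fourier]
  exact Finset.single_le_sum (f := fun k => ‖fourier z k‖ ^ 2) (fun _ _ => sq_nonneg _)
    (Finset.mem_univ k)

theorem norm_netMap_apply_le (z : Signal d) (W : Params d) : ‖netMap z W‖ ≤ ‖z‖ * ‖W‖ := by
  refine le_of_sq_le_sq ?_ (by positivity)
  rw [mul_pow, params_norm_sq, params_norm_sq, ← sum_norm_sq_fourier, ← sum_norm_sq_fourier,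
    ← sum_norm_sq_fourier W.fst, ← sum_norm_sq_fourier W.snd, add_comm, mul_add, Finset.mul_sum,
    Finset.mul_sum]
  simp only [fourier_netMap_fst, fourier_netMap_snd, norm_mul, RCLike.norm_conj, mul_pow]
  exact add_le_add
    (Finset.sum_le_sum fun k _ => mul_le_mul_of_nonneg_right
      (pow_le_pow_left₀ (norm_nonneg _) (norm_fourier_apply_le z k) 2) (sq_nonneg _))
    (Finset.sum_le_sum fun k _ => mul_le_mul_of_nonneg_right
      (pow_le_pow_left₀ (norm_nonneg _) (norm_fourier_apply_le z k) 2) (sq_nonneg _))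

theorem norm_inv_norm_smul_le {E : Type*} [NormedAddCommGroup E] [NormedSpace ℝ E] (u : E) :
    ‖‖u‖⁻¹ • u‖ ≤ 1 := by
  rw [norm_smul, norm_inv, norm_norm]
  exact inv_mul_le_one

/-- The limit direction of the negative gradients certifies that the limit direction of the
weights maximizes the margin. -/
theorem inner_limit_direction (hn : 0 < n) {x : Fin n → Signal d} {y : Fin n → ℝ}
    (hy : ∀ i, y i = 1 ∨ y i = -1) {W : ℕ → Params d} {V : Params d} {Z : Signal d}
    (hN : Tendsto (fun t => ‖W t‖ ^ 2) atTop atTop) (hV : ConvergesInDirection W V)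
    (hZ : ConvergesInDirection (fun t => weightedMean x y (predictor (W t))) Z)
    {i₀ : Fin n} (hmin : ∀ i, y i₀ * netOutput V (x i₀) ≤ y i * netOutput V (x i))
    (hpos : 0 < y i₀ * netOutput V (x i₀)) :
    0 < netOutput V Z ∧
    ∀ (β : Signal d) (r : ℝ), (∀ i, r ≤ y i * inner ℝ β (x i)) →
      r * netOutput V Z ≤ y i₀ * netOutput V (x i₀) * inner ℝ β Z := by
  set γ := y i₀ * netOutput V (x i₀) with hγ
  set z := fun t => weightedMean x y (predictor (W t)) with hz
  have hn' : (0 : ℝ) < n := Nat.cast_pos.2 hn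
  have hW0 : ∀ᶠ t in atTop, 0 < ‖W t‖ := by
    filter_upwards [hN.eventually_gt_atTop 0] with t ht
    exact norm_pos_iff.2 fun h => by simp [h] at ht
  have hL0 : ∀ t, 0 < netRisk x y (W t) := fun t => netRisk_pos hn x y (W t)
  have hz0 : ∀ t, 0 < ‖z t‖ := fun t => by
    have h1 := mul_linearRisk_le_inner_weightedMean (x := x) (y := y) (v := predictor V) (r := γ)
      (fun i => by rw [← netOutput_eq_inner]; exact hmin i) (predictor (W t))
    rw [linearRisk_predictor] at h1
    refine norm_pos_iff.2 fun h0 => ?_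
    change γ * netRisk x y (W t) ≤ inner ℝ (predictor V) (z t) at h1
    rw [h0, inner_zero_right] at h1
    exact absurd (mul_pos hpos (hL0 t)) (not_lt.2 h1)
  set ρ := fun t => netRisk x y (W t) / ‖z t‖ with hρ
  have hinner : ∀ (β : Signal d) t, inner ℝ β (‖z t‖⁻¹ • z t) = inner ℝ β (z t) / ‖z t‖ :=
    fun β t => by rw [real_inner_smul_right, div_eq_inv_mul]
  have hlim : ∀ β : Signal d, Tendsto (fun t => inner ℝ β (z t) / ‖z t‖) atTop
      (𝓝 (inner ℝ β Z)) := fun β => by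
    simp only [← hinner]
    exact tendsto_const_nhds.inner hZ
  have hμ : ∀ i, Tendsto (fun t => y i * netOutput (‖W t‖⁻¹ • W t) (x i)) atTop
      (𝓝 (y i * netOutput V (x i))) := fun i =>
    (((continuous_netOutput_left (x i)).tendsto V).comp hV).const_mul (y i)
  have hsoft := tendsto_softmin_average (γ := fun i => y i * netOutput V (x i)) hN hμ i₀ hmin
  have hratio : ∀ᶠ t in atTop,
      (∑ i, Real.exp (-(‖W t‖ ^ 2 * (y i * netOutput (‖W t‖⁻¹ • W t) (x i)))) *
        (y i * netOutput V (x i))) /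
      (∑ i, Real.exp (-(‖W t‖ ^ 2 * (y i * netOutput (‖W t‖⁻¹ • W t) (x i))))) =
      inner ℝ (predictor V) (z t) / netRisk x y (W t) := by
    filter_upwards [hW0] with t ht
    have h1 : ∀ i, ‖W t‖ ^ 2 * (y i * netOutput (‖W t‖⁻¹ • W t) (x i)) =
        y i * netOutput (W t) (x i) := fun i => by
      rw [netOutput_smul_left]
      field_simp
    simp only [h1, hz]
    rw [inner_weightedMean, netRisk, mul_div_mul_left _ _ (by positivity)]
    simp only [← netOutput_eq_inner]
  -- `⟪β(V), z⟫ / ‖z‖` tends to `netOutput V Z`, and `⟪β(V), z⟫ / risk` is a softmin average of the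
  -- margins of `V`, tending to `γ`; `ρ` is the quotient.
  have hρlim : Tendsto ρ atTop (𝓝 (netOutput V Z / γ)) := by
    rw [netOutput_eq_inner V Z]
    refine ((hlim (predictor V)).div (hsoft.congr' hratio) hpos.ne').congr' ?_
    have h1 : ∀ᶠ t in atTop, 0 < inner ℝ (predictor V) (z t) / netRisk x y (W t) :=
      (hsoft.congr' hratio).eventually (lt_mem_nhds hpos)
    filter_upwards [h1] with t ht
    have h2 : inner ℝ (predictor V) (z t) ≠ 0 := fun h0 => by simp [h0] at ht
    have h3 := (hL0 t).ne'
    have h4 := (hz0 t).ne'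
    simp only [Pi.div_apply, hρ]
    field_simp
  constructor
  -- The gradient norm is at most a constant times the risk, which keeps `ρ` away from zero.
  · have h1 : ∀ t, 1 ≤ (∑ i, ‖x i‖) * ρ t := fun t => by
      rw [hρ]
      simp only []
      rw [← mul_div_assoc, le_div_iff₀ (hz0 t), one_mul, ← linearRisk_predictor]
      exact norm_weightedMean_le x hy _
    have h2 := ge_of_tendsto' (hρlim.const_mul (∑ i, ‖x i‖)) h1
    have h3 : 0 < netOutput V Z / γ :=
      pos_of_mul_pos_right (lt_of_lt_of_le one_pos h2) (Finset.sum_nonneg fun i _ => norm_nonneg _)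
    exact (div_pos_iff_of_pos_right hpos).1 h3
  · intro β r hr
    have h1 : ∀ t, r * ρ t ≤ inner ℝ β (z t) / ‖z t‖ := fun t => by
      rw [hρ]
      simp only []
      rw [← mul_div_assoc, ← linearRisk_predictor]
      exact div_le_div_of_nonneg_right (mul_linearRisk_le_inner_weightedMean hr _) (hz0 t).le
    have h2 := le_of_tendsto_of_tendsto' (hρlim.const_mul r) (hlim β) h1
    rw [← mul_div_assoc, div_le_iff₀ hpos] at h2
    linarith

/-- Gradient descent aligns with the leading Fourier modes of the limit direction of the negative
gradients with respect to the linear predictor. -/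
theorem norm_fourier_limit_direction_le (hn : 0 < n) {x : Fin n → Signal d} {y : Fin n → ℝ}
    (hy : ∀ i, y i = 1 ∨ y i = -1) {η : ℕ → ℝ} {W : ℕ → Params d} {V : Params d} {Z : Signal d}
    (hgd : ∀ t, W (t + 1) = W t - η t • gradient (netRisk x y) (W t))
    (hη : ∀ t, 0 < η t ∧ η t * ‖hessian x y (W t)‖ < 1)
    (hN : Tendsto (fun t => ‖W t‖ ^ 2) atTop atTop) (hV : ConvergesInDirection W V)
    (hsep : ∀ i, 0 < y i * netOutput V (x i))
    (hZ : ConvergesInDirection (fun t => weightedMean x y (predictor (W t))) Z)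
    (hpos : 0 < netOutput V Z) (k : ZMod d)
    (h0 : ‖fourier (W 0).fst k‖ ^ 2 ≠ ‖fourier (W 0).snd k‖ ^ 2) :
    ‖fourier Z k‖ ≤ 2 * netOutput V Z := by
  rcases eq_or_ne (fourier Z k) 0 with hZ0 | hZ0
  · rw [hZ0, norm_zero]
    linarith
  set z := fun t => weightedMean x y (predictor (W t)) with hz
  have : Nonempty (Fin n) := ⟨⟨0, hn⟩⟩
  obtain ⟨i₀, hmin⟩ := Finite.exists_min fun i => y i * netOutput V (x i)
  have hz0 : ∀ t, ‖z t‖ • (‖z t‖⁻¹ • z t) = z t := fun t => by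
    rcases eq_or_ne (z t) 0 with h | h
    · simp [h]
    · rw [smul_smul, mul_inv_cancel₀ (norm_ne_zero_iff.2 h), one_smul]
  set Zt := fun t => ‖z t‖⁻¹ • z t with hZt
  -- Absorbing the gradient norm into the step size leaves driving directions `Zt` that converge.
  set s := fun t => η t * ‖z t‖ with hs
  have hs0 : ∀ t, 0 ≤ s t := fun t => mul_nonneg (hη t).1.le (norm_nonneg _)
  have hstep : ∀ t, W (t + 1) = W t + s t • netMap (Zt t) (W t) := fun t => by
    have h1 : s t • netMap (Zt t) (W t) = η t • netMap (z t) (W t) := by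
      have h2 : netMap (z t) (W t) = ‖z t‖ • netMap (Zt t) (W t) := by
        rw [← smul_apply, ← map_smul, hz0 t]
      rw [h2, smul_smul]
    rw [h1, hgd, gradient_netRisk, smul_neg, sub_neg_eq_add]
  -- The radial curvature is at least of order `‖W‖² * risk`, so the Hessian condition forces `η *
  -- risk = O(1 / ‖W‖²)`; the gradient norm is `O(risk)`.
  have hslim : Tendsto s atTop (𝓝 0) := by
    set c := y i₀ * netOutput V (x i₀) / 2 with hc
    have hc0 : 0 < c := half_pos (hsep i₀)
    have hmargin : ∀ᶠ t in atTop, ∀ i, c * ‖W t‖ ^ 2 ≤ y i * netOutput (W t) (x i) := by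
      refine eventually_all.2 fun i => ?_
      have h1 : Tendsto (fun t => y i * netOutput (‖W t‖⁻¹ • W t) (x i)) atTop
          (𝓝 (y i * netOutput V (x i))) :=
        (((continuous_netOutput_left (x i)).tendsto V).comp hV).const_mul (y i)
      have h2 : c < y i * netOutput V (x i) := by
        have := hmin i
        linarith [hsep i₀]
      filter_upwards [h1.eventually (lt_mem_nhds h2), hN.eventually_gt_atTop 0] with t h3 h4
      rw [netOutput_smul_left, inv_pow, mul_left_comm, ← div_eq_inv_mul, lt_div_iff₀ h4] at h3
      exact h3.le
    have hlim : Tendsto (fun t => (∑ i, ‖x i‖) / (2 * c ^ 2) * (‖W t‖ ^ 2)⁻¹) atTop (𝓝 0) := by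
      simpa using (tendsto_inv_atTop_zero.comp hN).const_mul ((∑ i, ‖x i‖) / (2 * c ^ 2))
    refine squeeze_zero' (Eventually.of_forall hs0) ?_ hlim
    filter_upwards [hmargin, (hN.const_mul_atTop hc0).eventually_ge_atTop 1,
      hN.eventually_gt_atTop 0] with t h1 h2 h3
    have h4 := mul_le_mul_of_nonneg_left (netRisk_mul_le_norm_hessian x y hc0 h2 h1) (hη t).1.le
    have h5 := norm_weightedMean_le x hy (predictor (W t))
    rw [linearRisk_predictor] at h5
    have h6 := mul_le_mul_of_nonneg_left h5 (hη t).1.le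
    have h7 : η t * netRisk x y (W t) ≤ (2 * c ^ 2 * ‖W t‖ ^ 2)⁻¹ := by
      rw [← one_div, le_div_iff₀ (by positivity)]
      linarith [(hη t).2]
    have h8 := mul_le_mul_of_nonneg_left h7
      (Finset.sum_nonneg fun i (_ : i ∈ Finset.univ) => norm_nonneg (x i))
    refine h6.trans ?_
    rw [mul_left_comm]
    refine h8.trans_eq ?_
    rw [mul_inv, div_eq_mul_inv]
    ring
  have hκ : Tendsto (fun t => 4 * netOutput (‖W t‖⁻¹ • W t) (Zt t) +
      s t * ‖netMap (Zt t) (‖W t‖⁻¹ • W t)‖ ^ 2 - 4 * netOutput V Z) atTop (𝓝 0) := by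
    have h1 : Tendsto (fun t => s t * ‖netMap (Zt t) (‖W t‖⁻¹ • W t)‖ ^ 2) atTop (𝓝 0) := by
      refine squeeze_zero (fun t => mul_nonneg (hs0 t) (sq_nonneg _)) (fun t => ?_) hslim
      refine mul_le_of_le_one_right (hs0 t) (pow_le_one₀ (norm_nonneg _) ?_)
      exact (norm_netMap_apply_le _ _).trans (mul_le_one₀ (norm_inv_norm_smul_le (z t))
        (norm_nonneg _) (norm_inv_norm_smul_le (W t)))
    have h2 : Tendsto (fun t => netOutput (‖W t‖⁻¹ • W t) (Zt t)) atTop (𝓝 (netOutput V Z)) := by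
      simp only [netOutput_eq_inner]
      exact ((continuous_predictor.tendsto V).comp hV).inner hZ
    simpa using ((h2.const_mul 4).add h1).sub_const (4 * netOutput V Z)
  have hfst : ∀ t, fourier (W (t + 1)).fst k = fourier (W t).fst k +
      s t * (conj (fourier (Zt t) k) * fourier (W t).snd k) := fun t => by
    rw [hstep, WithLp.add_fst, WithLp.smul_fst, fourier_add, fourier_smul, fourier_netMap_fst]
  have hsnd : ∀ t, fourier (W (t + 1)).snd k = fourier (W t).snd k +
      s t * (fourier (Zt t) k * fourier (W t).fst k) := fun t => by
    rw [hstep, WithLp.add_snd, WithLp.smul_snd, fourier_add, fourier_smul, fourier_netMap_snd]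
  have hsmall : ∀ t, s t * ‖fourier (Zt t) k‖ < 1 := fun t => by
    have h1 : ‖fourier (z t) k‖ = ‖z t‖ * ‖fourier (Zt t) k‖ := by
      conv_lhs => rw [← hz0 t]
      rw [fourier_smul, norm_mul, Complex.norm_real, norm_norm]
    rw [hs]
    simp only []
    rw [mul_assoc, ← h1]
    exact (mul_le_mul_of_nonneg_left (norm_fourier_weightedMean_le x y (W t) k)
      (hη t).1.le).trans_lt (hη t).2
  have henergy : ∀ t, ‖fourier (W t).fst k‖ ^ 2 + ‖fourier (W t).snd k‖ ^ 2 ≤ ‖W t‖ ^ 2 :=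
    fun t => by
    rw [params_norm_sq, ← sum_norm_sq_fourier, ← sum_norm_sq_fourier]
    exact add_le_add
      (Finset.single_le_sum (f := fun k => ‖fourier (W t).fst k‖ ^ 2) (fun _ _ => sq_nonneg _)
        (Finset.mem_univ k))
      (Finset.single_le_sum (f := fun k => ‖fourier (W t).snd k‖ ^ 2) (fun _ _ => sq_nonneg _)
        (Finset.mem_univ k))
  have hgrow := two_mul_norm_le_of_growth (Λ := 4 * netOutput V Z) hZ0 hs0 hslim
    (((continuous_fourier_apply k).tendsto Z).comp hZ) hfst hsnd hsmall h0 henergy hN hκ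
    (fun t => by rw [hstep, norm_sq_add_smul_netMap, add_sub_cancel])
  linarith

theorem ConvergesInDirection.norm_eq_one {E : Type*} [NormedAddCommGroup E] [NormedSpace ℝ E]
    {u : ℕ → E} {v : E} (h : ConvergesInDirection u v) (hu : ∀ᶠ t in atTop, u t ≠ 0) :
    ‖v‖ = 1 := by
  refine tendsto_nhds_unique h.norm (tendsto_const_nhds.congr' ?_)
  filter_upwards [hu] with t ht
  rw [norm_smul, norm_inv, norm_norm, inv_mul_cancel₀ (norm_ne_zero_iff.2 ht)]

theorem convergesInDirection_predictor {W : ℕ → Params d} {V : Params d}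
    (h : ConvergesInDirection W V) (hW : ∀ᶠ t in atTop, W t ≠ 0) (hV : predictor V ≠ 0) :
    ConvergesInDirection (fun t => predictor (W t)) (‖predictor V‖⁻¹ • predictor V) := by
  have h1 : Tendsto (fun t => predictor (‖W t‖⁻¹ • W t)) atTop (𝓝 (predictor V)) :=
    (continuous_predictor.tendsto V).comp h
  refine ((h1.norm.inv₀ (norm_ne_zero_iff.2 hV)).smul h1).congr' ?_
  filter_upwards [hW] with t ht
  have h2 : ‖W t‖ ≠ 0 := norm_ne_zero_iff.2 ht
  rw [predictor_smul, norm_smul, smul_smul, norm_pow, norm_inv, norm_norm]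
  congr 1
  field_simp

theorem exists_isMaximallyRobust_of_gradientDescent (hn : 0 < n) {x : Fin n → Signal d}
    {y : Fin n → ℝ} (hy : ∀ i, y i = 1 ∨ y i = -1) {η : ℕ → ℝ} {W : ℕ → Params d} {V : Params d}
    {g : Signal d} (hgd : ∀ t, W (t + 1) = W t - η t • gradient (netRisk x y) (W t))
    (hη : ∀ t, 0 < η t ∧ η t * ‖hessian x y (W t)‖ < 1)
    (hL : Tendsto (fun t => netRisk x y (W t)) atTop (𝓝 0)) (hV : ConvergesInDirection W V)
    (hsep : ∀ i, 0 < y i * netOutput V (x i))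
    (hg : ConvergesInDirection (fun t => gradient (linearRisk x y) (predictor (W t))) g)
    (h0 : ∀ k, ‖fourier (W 0).fst k‖ ^ 2 ≠ ‖fourier (W 0).snd k‖ ^ 2) :
    ∃ U : Params d, ConvergesInDirection (fun t => predictor (W t)) (predictor U) ∧
      IsMaximallyRobust x y U := by
  have : Nonempty (Fin n) := ⟨⟨0, hn⟩⟩
  obtain ⟨i₀, hmin⟩ := Finite.exists_min fun i => y i * netOutput V (x i)
  have hN := tendsto_norm_sq_atTop hn hy hL
  have hW0 : ∀ᶠ t in atTop, W t ≠ 0 := by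
    filter_upwards [hN.eventually_gt_atTop 0] with t ht h
    simp [h] at ht
  have hZ : ConvergesInDirection (fun t => weightedMean x y (predictor (W t))) (-g) := by
    refine hg.neg.congr fun t => ?_
    simp only []
    rw [gradient_linearRisk, norm_neg, smul_neg, neg_neg]
  obtain ⟨hpos, hdual⟩ := inner_limit_direction hn hy hN hV hZ hmin (hsep i₀)
  have hβ : predictor V ≠ 0 := fun h => by
    rw [netOutput_eq_inner, h, inner_zero_left] at hpos
    exact lt_irrefl _ hpos
  have hβ' : 0 < ‖predictor V‖⁻¹ := inv_pos.2 (norm_pos_iff.2 hβ)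
  have hmax : IsMaximallyRobust x y V :=
    isMaximallyRobust_of_certificate hn hy (hV.norm_eq_one hW0) hmin
      (fun k => norm_fourier_limit_direction_le hn hy hgd hη hN hV hsep hZ hpos k (h0 k)) hpos
      (fun β r _ => hdual β r) (hsep i₀)
  -- The predictor is quadratic in the weights, so this factor gives it norm one, as a limit
  -- direction requires; rescaling does not affect robustness.
  refine ⟨√‖predictor V‖⁻¹ • V, ?_, hmax.smul (Real.sqrt_pos.2 hβ').ne'⟩
  rw [predictor_smul, Real.sq_sqrt hβ'.le]
  exact convergesInDirection_predictor hV hW0 hβ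

end LinConv

end

theorem mainTheorem2 (d n : ℕ) [NeZero d] (hn : 0 < n)
    (y : Fin n → ℝ) (hy : ∀ i, y i = 1 ∨ y i = -1) :
    ∀ᵐ x : Fin n → LinConv.Signal d, LinConv.LinearlySeparable x y →
      ∀ᵐ W₀ : LinConv.Params d, ∀ η : ℕ → ℝ, ∀ W : ℕ → LinConv.Params d,
        W = LinConv.gdIterates x y η W₀ →
        -- step sizes below the inverse local Lipschitz constant of the gradient
        (∀ t, 0 < η t ∧ η t * ‖LinConv.hessian x y (W t)‖ < 1) →
        -- the iterates minimize the empirical risk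
        Tendsto (fun t => LinConv.netRisk x y (W t)) atTop (𝓝 0) →
        -- the weights converge in direction, to a separator with positive margin
        (∃ V : LinConv.Params d, LinConv.ConvergesInDirection W V ∧
          ∀ i, 0 < y i * LinConv.netOutput V (x i)) →
        -- the gradients with respect to the linear predictor converge in direction
        (∃ g : LinConv.Signal d, LinConv.ConvergesInDirection
          (fun t => gradient (LinConv.linearRisk x y) (LinConv.predictor (W t))) g) →
        ∃ U : LinConv.Params d,
          LinConv.ConvergesInDirection (fun t => LinConv.predictor (W t))
            (LinConv.predictor U) ∧
          LinConv.IsMaximallyRobust x y U := by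
  refine Eventually.of_forall fun x _ => ?_
  -- The exceptional set of initializations does not involve the step sizes, so one null set serves
  -- every `η`.
  filter_upwards [LinConv.ae_norm_fourier_ne d] with W₀ hW₀ η W hW hη hL hV hg
  subst hW
  obtain ⟨V, hV, hsep⟩ := hV
  obtain ⟨g, hg⟩ := hg
  exact LinConv.exists_isMaximallyRobust_of_gradientDescent hn hy (fun _ => rfl) hη hL hV hsep hg
    hW₀
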